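/- **Setting.** Let $e_1,e_2,e_3\in\mathbb C$ be distinct, let $f(x)=(x-e_1)(x-e_2)(x-e_3)$, let $E_e$ be the elliptic curve $y^2=f(x)$ with the differential $du=\frac{dx}{2y}$, and write $e_{ij}=e_i-e_j$. An *elastica* (loop soliton of genus one) on $E_e$ based at $e_a$ is a plane curve $Z:\mathbb R\to\mathbb C$ with $$\partial_uZ=\mathrm e^{\sqrt{-1}\,\phi},\qquad \mu\,\partial_u\phi+\tfrac12(\partial_u\phi)^3+\partial_u^3\phi=0$$ for a real $C^3$ function $\phi$ and a real constant $\mu$, such that $\partial_uZ=x-e_a$ for a motion $u\mapsto(x(u),y(u))$, $u\in\mathbb R$, on $E_e$ along which $\frac{dx}{2y}=\frac{dy}{f'(x)}=du$ (that is, $x'=2y$ and $y'=f'(x)$). For $\{a,b,c\}=\{1,2,3\}$ put $\mathrm e^{2\sqrt{-1}\varphi_a}=(x-e_a)/\sqrt{e_{ba}e_{ca}}$ and $w=\sin\varphi_a$, and let $J$ be the curve $$v^2=(1-w^2)\left((\sqrt{e_{ba}}-\sqrt{e_{ca}})^2+4\sqrt{e_{ba}e_{ca}}\,w^2\right),$$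 which has modulus $k=2\sqrt{-1}\,\sqrt[4]{e_{ba}e_{ca}}/(\sqrt{e_{ba}}-\sqrt{e_{ca}})$; the roots are principal values. (When $\sqrt{e_{ba}}\sqrt{e_{ca}}=\sqrt{e_{ba}e_{ca}}$, one has $du=\frac{dw}{v}$.) A *period ratio* of $E_e$ (of $J$) is a number $\tau=\omega_2/\omega_1$ in the upper half plane, where $(\omega_1,\omega_2)$ is a $\mathbb Z$-basis of the group of periods of $\frac{dx}{2y}$ (of $\frac{dw}{v}$) along closed paths on the curve. **Proposition (Mumford).** 1. The moduli of elasticas, i.e. the set of classes modulo $\mathrm{PSL}(2,\mathbb Z)$ of the period ratios of the curves $E_e$ that carry an elastica, is $$\Lambda=\sqrt{-1}\,\mathbb R_{>0}\ \cup\ \left(\tfrac12+\sqrt{-1}\,\mathbb R_{>0}\right)\quad\text{modulo } \mathrm{PSL}(2,\mathbb Z).$$ The same set $\Lambda$ is obtained if the period ratios of $E_e$ are replaced by those of the curves $J$ with the same $e$ and the same base point $e_a$. 2. If $E_e$ carries an elastica based at $e_a$, then either $e_{ba},e_{ca}$ are both real and positive, or they are complex conjugates of each other and not real. 3. (Case I-1)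 If $e_1,e_2,e_3$ are distinct and $e_{ba},e_{ca}$ are real and positive, then $J$ has a period ratio on $\frac12+\sqrt{-1}\,\mathbb R_{>0}$. 4. (Case I-2) If $e_1,e_2,e_3$ are distinct and either $e_{ba},e_{ca}$ are real and $\le0$ with $k^2\neq1$, or $e_{ba},e_{ca}$ are complex conjugates of each other and not real, then $J$ has a period ratio on $\sqrt{-1}\,\mathbb R_{>0}$. -/

import Mathlib

open Polynomial UpperHalfPlane
open scoped MatrixGroups

noncomputable section

namespace GenusOne

/-! ### Period ratios of a curve `v ^ 2 = P w` -/

/-- The set of periods of the differential `dw / v` on the curve `v ^ 2 = P w`: its integrals over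
the `C¹` closed paths `t ↦ (w t, v t)`, `0 ≤ t ≤ 1`, in the part `v ≠ 0` of the affine curve. -/
def periods (P : ℂ[X]) : Set ℂ :=
  {ω | ∃ w v : ℝ → ℂ, ContDiff ℝ 1 w ∧ Continuous v ∧
    (∀ t ∈ Set.Icc (0 : ℝ) 1, v t ^ 2 = P.eval (w t) ∧ v t ≠ 0) ∧
    w 0 = w 1 ∧ v 0 = v 1 ∧
    ω = ∫ t in (0 : ℝ)..1, deriv w t / v t}

/-- `τ` is a period ratio of the curve `v ^ 2 = P w`: the periods of `dw / v` have a `ℤ`-basis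
`(ω₁, ω₂)` with `ω₂ / ω₁ = τ`. (A constant factor, as in `dw / (2 v)`, does not change this.) -/
def IsPeriodRatio (P : ℂ[X]) (τ : ℍ) : Prop :=
  ∃ ω₁ ω₂ : ℂ, ω₁ ≠ 0 ∧ ω₂ / ω₁ = (τ : ℂ) ∧
    periods P = {ω | ∃ m n : ℤ, ω = m * ω₁ + n * ω₂}

/-! ### The curves -/

/-- The polynomial of the curve `y ^ 2 = (x - e₁) (x - e₂) (x - e₃)`. -/
def cubic (e : Fin 3 → ℂ) : ℂ[X] := ∏ i, (X - C (e i))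

/-- With `p = e_b - e_a` and `q = e_c - e_a`, the polynomial of the curve
`v ^ 2 = (1 - w ^ 2) ((√p - √q) ^ 2 + 4 √(p q) w ^ 2)`, with principal square roots. If
`√p √q = √(p q)`, then `du = dw / v` on it for `w = sin φ`, `e ^ (2 i φ) = (x - e_a) / √(p q)`. -/
def quartic (p q : ℂ) : ℂ[X] :=
  (1 - X ^ 2) * (C ((Complex.sqrt p - Complex.sqrt q) ^ 2) + C (4 * Complex.sqrt (p * q)) * X ^ 2)

/-- The Jacobi modulus `k = 2 i (p q) ^ (1/4) / (√p - √q)`. -/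
def jacobiModulus (p q : ℂ) : ℂ :=
  2 * Complex.I * (p * q) ^ (4⁻¹ : ℂ) / (Complex.sqrt p - Complex.sqrt q)

/-! ### Elasticas -/

/-- A plane curve `Z`, parametrized by arc length `u`, is an elastica: `Z' = e ^ (i φ)` where
`μ φ' + (φ') ^ 3 / 2 + φ''' = 0` for a real constant `μ`. -/
def IsElastica (Z : ℝ → ℂ) : Prop :=
  ∃ φ : ℝ → ℝ, ContDiff ℝ 3 φ ∧
    (∀ u, HasDerivAt Z (Complex.exp (φ u * Complex.I)) u) ∧
    ∃ μ : ℝ, ∀ u, μ * deriv φ u + (deriv φ u) ^ 3 / 2 + iteratedDeriv 3 φ u = 0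

/-- `Z' = x - e_a`, where `u ↦ (x, y)` moves on `y ^ 2 = (x - e₁) (x - e₂) (x - e₃)` in such a way
that the invariant differential `dx / (2 y) = dy / f'(x)`, `f` the cubic, pulls back to `du`. -/
def IsCarriedBy (Z : ℝ → ℂ) (e : Fin 3 → ℂ) (a : Fin 3) : Prop :=
  ∃ x y : ℝ → ℂ, ∀ u : ℝ,
    y u ^ 2 = (cubic e).eval (x u) ∧
    HasDerivAt x (2 * y u) u ∧
    HasDerivAt y ((cubic e).derivative.eval (x u)) u ∧
    HasDerivAt Z (x u - e a) u

/-- `Z` is an elastica (loop soliton of genus one) on the elliptic curve with the distinct branch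
points `e₁, e₂, e₃`, based at `e_a`. -/
def IsGenusOneElastica (Z : ℝ → ℂ) (e : Fin 3 → ℂ) (a : Fin 3) : Prop :=
  Function.Injective e ∧ IsElastica Z ∧ IsCarriedBy Z e a

/-! ### Moduli -/

/-- The upper half plane modulo the modular group. (`-1` acts trivially, so the orbits of
`SL(2, ℤ)` are those of `PSL(2, ℤ)`.) -/
abbrev ModularQuotient : Type := MulAction.orbitRel.Quotient SL(2, ℤ) ℍ

/-- The class of a point of the upper half plane. -/
def toQuotient (τ : ℍ) : ModularQuotient := Quotient.mk (MulAction.orbitRel SL(2, ℤ) ℍ) τ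

/-- The subset `i ℝ_{>0} ∪ (1/2 + i ℝ_{>0})` of the upper half plane. -/
def twoLines : Set ℍ := {τ | τ.re = 0 ∨ τ.re = 1 / 2}

/-- The moduli of elasticas: the classes of the period ratios of the elliptic curves
`y ^ 2 = (x - e₁) (x - e₂) (x - e₃)` that carry an elastica. -/
def elasticaModuli : Set ModularQuotient :=
  {s | ∃ (Z : ℝ → ℂ) (e : Fin 3 → ℂ) (a : Fin 3) (τ : ℍ),
    IsGenusOneElastica Z e a ∧ IsPeriodRatio (cubic e) τ ∧ s = toQuotient τ}

/-- The same, with the period ratios taken on the quartic curve uniformized by `w = sin φ`. -/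
def elasticaAmplitudeModuli : Set ModularQuotient :=
  {s | ∃ (Z : ℝ → ℂ) (e : Fin 3 → ℂ) (a b c : Fin 3) (τ : ℍ),
    IsGenusOneElastica Z e a ∧ a ≠ b ∧ a ≠ c ∧ b ≠ c ∧
    IsPeriodRatio (quartic (e b - e a) (e c - e a)) τ ∧ s = toQuotient τ}

/-- `p` and `q` are both real and positive. -/
def BothPos (p q : ℂ) : Prop := p.im = 0 ∧ q.im = 0 ∧ 0 < p.re ∧ 0 < q.re

/-- `p` and `q` are both real and nonpositive. -/
def BothNonpos (p q : ℂ) : Prop := p.im = 0 ∧ q.im = 0 ∧ p.re ≤ 0 ∧ q.re ≤ 0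

/-- `p` and `q` are complex conjugates of each other and not real. -/
def ConjPair (p q : ℂ) : Prop := q = (starRingEnd ℂ) p ∧ p.im ≠ 0

end GenusOne

end

open GenusOne

/-! Elasticas. Put E = x - e_a = e^(iφ), p = e_b - e_a, q = e_c - e_a. The motion on the curve reads
φ'² E = -4 (E - p)(E - q) and i φ'' E = 2 (E² - p q). As |E| = 1 and φ is real, this forces p q = 1
and p + q = s real with s > -2, s ≠ 2 (`IsGenusOneElastica.mul_eq_one`). Conversely, for such s the
pendulum equation φ'² = 4 s - 8 cos φ has a nonconstant global solution, and it is an elastica with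
μ = -2 s. So p, q are the roots of t² - s t + 1: real and positive for s > 2, conjugate and nonreal
for s < 2.

Reduction to one family. E_e is a translate of y² = x (x² - 2 c x + 1) with c = s / 2. The map w =
(x + 1) / (x - 1) carries a curve of the same family to J, up to a constant factor, with c = (A - R)
/ (A + R), A = (√p - √q)², R = 4 √(p q). Since c² - 1 = -4 A R / (A + R)², the signs of A and R
decide whether |c| < 1 or |c| > 1.

Lattices of the family. The claim is that |c| < 1 gives rhombic lattices (Re τ = 1/2), |c| > 1
rectangular ones (Re τ = 0), and that all of these occur. Given the lattice, ℘ produces the curve,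
and the sides of the lattice are, up to a common factor, two complete real integrals of the curve
(`exists_rectangular`, `exists_rhombic`). Given the curve, take the lattice whose sides are its two
integrals. The curve of that lattice has integrals proportional to the given ones; as one integral
increases with the parameter and the other decreases, the two parameters agree.

Periods. Closed paths on the curve lift through (℘, ℘') and segments project back, so the integrals
of dw/v are exactly the lattice (`Uniformizes.periods_eq`). Two bases of one lattice with ratios in
the upper half plane differ by SL(2, ℤ), so one known period ratio determines the class of all of
them. -/

namespace GenusOne

open Filter Topology Set MeasureTheory

/-! ### Uniformization of `v ^ 2 = P w` and its periods -/

/-- The functions `W` and `V = W'`, defined outside the countable closed set `D` and periodic with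
respect to `Λ`, uniformize the part `v ≠ 0` of the curve `v ^ 2 = P w`. -/
structure Uniformizes (P : ℂ[X]) (Λ : Set ℂ) (W V : ℂ → ℂ) (D : Set ℂ) : Prop where
  isClosed : IsClosed D
  countable : D.Countable
  hasDerivAt : ∀ z ∉ D, HasDerivAt W (V z) z
  continuousAt : ∀ z ∉ D, ContinuousAt V z
  ne_zero : ∀ z ∉ D, V z ≠ 0
  sq_eq : ∀ z ∉ D, V z ^ 2 = P.eval (W z)
  -- A substitute for properness: W does not accumulate, at a point of D, at any w with P(w) ≠ 0, so
  -- the lift of a path with v ≠ 0 cannot run into D.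
  avoids : ∀ z ∈ D, ∀ w, P.eval w ≠ 0 → ∃ U ∈ 𝓝 w, ∀ᶠ z' in 𝓝[≠] z, z' ∉ D → W z' ∉ U
  surj : ∀ w v, v ≠ 0 → v ^ 2 = P.eval w → ∃ z, z ∉ D ∧ W z = w ∧ V z = v
  inj : ∀ z ∉ D, ∀ z' ∉ D, W z = W z' → V z = V z' → z' - z ∈ Λ
  add_notMem : ∀ z ∉ D, ∀ l ∈ Λ, z + l ∉ D
  map_add : ∀ z ∉ D, ∀ l ∈ Λ, W (z + l) = W z ∧ V (z + l) = V z

/-- Among the lines parallel to ω only countably many meet D, one for each value of Im (d / ω). The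
line found here carries the closed path that realizes the period ω. -/
theorem exists_line_avoiding {D : Set ℂ} (hD : D.Countable) (ω : ℂ) :
    ∃ z : ℂ, ∀ t : ℝ, z + t * ω ∉ D := by
  rcases eq_or_ne ω 0 with rfl | hω
  · obtain ⟨z, hz⟩ := (hD.dense_compl ℝ).nonempty
    exact ⟨z, fun t => by simpa using hz⟩
  · obtain ⟨s, hs⟩ := ((hD.image fun d => (d / ω).im).dense_compl ℝ).nonempty
    refine ⟨s * Complex.I * ω, fun t ht => hs ⟨_, ht, ?_⟩⟩
    have : (s * Complex.I * ω + t * ω) / ω = s * Complex.I + t := by field_simp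
    simp [this]

/-- A path that agrees at one time with the image of a solution of `du = dw / v` agrees with it
nearby. -/
theorem Uniformizes.eventually_eq {P : ℂ[X]} {Λ : Set ℂ} {W V : ℂ → ℂ} {D : Set ℂ}
    (h : Uniformizes P Λ W V D) {I : Set ℝ} (hI : Convex ℝ I) {w v u : ℝ → ℂ} {t₀ : ℝ}
    (ht₀ : t₀ ∈ I)
    (hw : Differentiable ℝ w) (hv : Continuous v)
    (hP : ∀ t ∈ I, v t ^ 2 = P.eval (w t) ∧ v t ≠ 0)
    (hu : ∀ t ∈ I, HasDerivAt u (deriv w t / v t) t)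
    (hD : u t₀ ∉ D) (hW : W (u t₀) = w t₀) (hV : V (u t₀) = v t₀) :
    ∀ᶠ t in 𝓝 t₀, t ∈ I → u t ∉ D ∧ W (u t) = w t ∧ V (u t) = v t := by
  have hDo : ∀ᶠ z in 𝓝 (u t₀), z ∉ D := h.isClosed.isOpen_compl.mem_nhds hD
  have hst : HasStrictDerivAt W (V (u t₀)) (u t₀) :=
    hasStrictDerivAt_of_hasDerivAt_of_continuousAt (hDo.mono h.hasDerivAt) (h.continuousAt _ hD)
  have hst' := hst.hasStrictFDerivAt_equiv (h.ne_zero _ hD)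
  set F := hst'.toOpenPartialHomeomorph W with hF
  have hFW : (F : ℂ → ℂ) = W := hst'.toOpenPartialHomeomorph_coe
  have hsrc : u t₀ ∈ F.source := hst'.mem_toOpenPartialHomeomorph_source
  have htgt : w t₀ ∈ F.target := by
    rw [← hW]; exact hst'.image_mem_toOpenPartialHomeomorph_target
  have hsymm : F.symm (w t₀) = u t₀ := by rw [← hW, ← hFW]; exact F.left_inv hsrc
  have hwc : ContinuousAt w t₀ := hw.continuous.continuousAt
  have hyc : ContinuousAt (fun t => F.symm (w t)) t₀ :=
    (F.symm.continuousAt htgt).comp hwc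
  have h1 : ∀ᶠ t in 𝓝 t₀, w t ∈ F.target := hwc (F.open_target.mem_nhds htgt)
  have h2 : ∀ᶠ t in 𝓝 t₀, F.symm (w t) ∉ D :=
    Tendsto.eventually (p := (· ∉ D)) hyc (by simpa only [hsymm] using hDo)
  -- The equation of the curve fixes V only up to sign. The sum is 2 v(t₀) ≠ 0 at t₀, so by
  -- continuity V = -v is excluded nearby.
  have h3 : ∀ᶠ t in 𝓝 t₀, V (F.symm (w t)) + v t ≠ 0 := by
    have hc : ContinuousAt (fun t => V (F.symm (w t)) + v t) t₀ := by
      refine ContinuousAt.add (ContinuousAt.comp (g := V) ?_ hyc) hv.continuousAt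
      rw [hsymm]; exact h.continuousAt _ hD
    apply hc.eventually_ne
    rw [hsymm, hV, ← two_mul]
    exact mul_ne_zero two_ne_zero (hP t₀ ht₀).2
  obtain ⟨ε, hε, hball⟩ := Metric.eventually_nhds_iff_ball.mp (h1.and (h2.and h3))
  have key : ∀ t ∈ Metric.ball t₀ ε ∩ I,
      W (F.symm (w t)) = w t ∧ F.symm (w t) ∉ D ∧ V (F.symm (w t)) = v t := by
    rintro t ⟨htb, htI⟩
    obtain ⟨ha, hb, hc⟩ := hball t htb
    have e1 : W (F.symm (w t)) = w t := by rw [← hFW]; exact F.right_inv ha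
    refine ⟨e1, hb, ?_⟩
    have e2 := h.sq_eq _ hb
    rw [e1, ← (hP t htI).1, sq_eq_sq_iff_eq_or_eq_neg] at e2
    rcases e2 with e2 | e2
    · exact e2
    · exact absurd (by rw [e2]; ring) hc
  -- The local inverse of W along w and the function u both have derivative w'/v, so their
  -- difference is constant on this convex set.
  have hder : ∀ t ∈ Metric.ball t₀ ε ∩ I,
      HasDerivWithinAt (fun t => F.symm (w t) - u t) 0 (Metric.ball t₀ ε ∩ I) t := by
    rintro t ht
    obtain ⟨e1, hb, e2⟩ := key t ht
    have d1 : HasDerivAt F.symm (V (F.symm (w t)))⁻¹ (w t) :=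
      F.hasDerivAt_symm (hball t ht.1).1 (h.ne_zero _ hb) (by rw [hFW]; exact h.hasDerivAt _ hb)
    have d2 := d1.comp_of_eq t (hw t).hasDerivAt rfl
    have d3 := (d2.sub (hu t ht.2)).hasDerivWithinAt (s := Metric.ball t₀ ε ∩ I)
    rw [e2, inv_mul_eq_div, sub_self] at d3
    exact d3
  have hconst : ∀ t ∈ Metric.ball t₀ ε ∩ I, F.symm (w t) = u t := by
    intro t ht
    have := ((convex_ball t₀ ε).inter hI).norm_image_sub_le_of_norm_hasDerivWithin_le (C := 0)
      hder (by simp) ⟨Metric.mem_ball_self hε, ht₀⟩ ht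
    simp only [hsymm, sub_self, sub_zero, zero_mul, norm_le_zero_iff, sub_eq_zero] at this
    exact this
  filter_upwards [Metric.ball_mem_nhds t₀ hε] with t htb htI
  rw [← hconst t ⟨htb, htI⟩]
  exact ⟨(key t ⟨htb, htI⟩).2.1, (key t ⟨htb, htI⟩).1, (key t ⟨htb, htI⟩).2.2⟩

/-- The lift of a path on the curve to the uniformizing plane. -/
theorem Uniformizes.lift {P : ℂ[X]} {Λ : Set ℂ} {W V : ℂ → ℂ} {D : Set ℂ}
    (h : Uniformizes P Λ W V D) {w v u : ℝ → ℂ}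
    (hw : Differentiable ℝ w) (hv : Continuous v)
    (hP : ∀ t ∈ Icc (0 : ℝ) 1, v t ^ 2 = P.eval (w t) ∧ v t ≠ 0)
    (hu : ∀ t ∈ Icc (0 : ℝ) 1, HasDerivAt u (deriv w t / v t) t)
    (hD : u 0 ∉ D) (hW : W (u 0) = w 0) (hV : V (u 0) = v 0) :
    ∀ t ∈ Icc (0 : ℝ) 1, u t ∉ D ∧ W (u t) = w t ∧ V (u t) = v t := by
  set S : Set (Icc (0 : ℝ) 1) := {t | u t ∉ D ∧ W (u t) = w t ∧ V (u t) = v t} with hS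
  have hopen : IsOpen S := by
    rw [isOpen_iff_mem_nhds]
    intro t ht
    have := h.eventually_eq (convex_Icc 0 1) t.2 hw hv hP hu ht.1 ht.2.1 ht.2.2
    filter_upwards [continuous_subtype_val.continuousAt.eventually this] with s hs
    exact hs s.2
  have huc : ∀ t : Icc (0 : ℝ) 1, ContinuousAt (fun s : Icc (0 : ℝ) 1 => u s) t := fun t =>
    (hu t t.2).continuousAt.comp continuous_subtype_val.continuousAt
  have hclosed : IsClosed S := by
    rw [isClosed_iff_frequently]
    intro t ht
    have hwc : ContinuousAt (fun s : Icc (0 : ℝ) 1 => w s) t :=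
      (hw.continuous.comp continuous_subtype_val).continuousAt
    have hvc : ContinuousAt (fun s : Icc (0 : ℝ) 1 => v s) t :=
      (hv.comp continuous_subtype_val).continuousAt
    -- If u(t) were in D, `avoids` would keep W(u(s)) away from w(t) for s near t, whereas W(u(s)) =
    -- w(s) → w(t) along points of S.
    have hDt : u t ∉ D := by
      intro hDt
      have hne : P.eval (w t) ≠ 0 := by
        rw [← (hP t t.2).1]; exact pow_ne_zero _ (hP t t.2).2
      obtain ⟨U, hU, hev⟩ := h.avoids _ hDt _ hne
      rw [eventually_nhdsWithin_iff] at hev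
      obtain ⟨s, hs, hs1, hs2⟩ := (ht.and_eventually
        (((huc t).eventually hev).and (hwc.eventually hU))).exists
      refine hs1 ?_ hs.1 (by rw [hs.2.1]; exact hs2)
      intro hst
      exact hs.1 (by rw [show u s = u t from hst]; exact hDt)
    refine ⟨hDt, ?_, ?_⟩
    · exact tendsto_nhds_unique_of_frequently_eq
        ((h.hasDerivAt _ hDt).continuousAt.tendsto.comp (huc t)) hwc (ht.mono fun s hs => hs.2.1)
    · exact tendsto_nhds_unique_of_frequently_eq
        ((h.continuousAt _ hDt).tendsto.comp (huc t)) hvc (ht.mono fun s hs => hs.2.2)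
  have huniv : S = univ := by
    refine (isClopen_iff.mp ⟨hclosed, hopen⟩).resolve_left (Set.Nonempty.ne_empty ?_)
    exact ⟨⟨0, by simp⟩, hD, hW, hV⟩
  intro t ht
  have : (⟨t, ht⟩ : Icc (0 : ℝ) 1) ∈ S := huniv ▸ mem_univ _
  exact this

/-- The integral of dw/v is the displacement of the lift. A closed path has the same (W, V) at both
ends of its lift, so by `inj` the displacement lies in Λ. -/
theorem Uniformizes.periods_subset {P : ℂ[X]} {Λ : Set ℂ} {W V : ℂ → ℂ} {D : Set ℂ}
    (h : Uniformizes P Λ W V D) : periods P ⊆ Λ := by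
  rintro ω ⟨w, v, hw, hv, hP, hw01, hv01, rfl⟩
  have h0 : (0 : ℝ) ∈ Icc (0 : ℝ) 1 := by simp
  have h1 : (1 : ℝ) ∈ Icc (0 : ℝ) 1 := by simp
  obtain ⟨z₀, hz₀, hW, hV⟩ := h.surj (w 0) (v 0) (hP 0 h0).2 (hP 0 h0).1
  -- The path is on the curve only for 0 ≤ t ≤ 1. Clamping t makes the integrand continuous on ℝ, so
  -- its primitive is differentiable at the endpoints as well.
  let π : ℝ → Icc (0 : ℝ) 1 := projIcc 0 1 zero_le_one
  have hπ : ∀ t ∈ Icc (0 : ℝ) 1, (π t : ℝ) = t := fun t ht => by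
    simp only [π]; rw [projIcc_of_mem _ ht]
  have hπc : Continuous fun t => (π t : ℝ) := continuous_subtype_val.comp continuous_projIcc
  have hg : Continuous fun t => deriv w (π t) / v (π t) :=
    ((hw.continuous_deriv le_rfl).comp hπc).div (hv.comp hπc) fun t => (hP _ (π t).2).2
  set u : ℝ → ℂ := fun t => z₀ + ∫ s in (0 : ℝ)..t, deriv w (π s) / v (π s) with hu
  have hud : ∀ t ∈ Icc (0 : ℝ) 1, HasDerivAt u (deriv w t / v t) t := by
    intro t ht
    have := (hg.integral_hasStrictDerivAt 0 t).hasDerivAt.const_add z₀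
    rwa [hπ t ht] at this
  have hu0 : u 0 = z₀ := by simp [hu]
  have hlift := h.lift (hw.differentiable one_ne_zero) hv hP hud (by rwa [hu0])
    (by rwa [hu0]) (by rwa [hu0])
  obtain ⟨l0, l1, l2⟩ := hlift 1 h1
  have := h.inj z₀ hz₀ (u 1) l0 (by rw [hW, l1, hw01]) (by rw [hV, l2, hv01])
  convert this using 1
  simp only [hu, add_sub_cancel_left]
  apply intervalIntegral.integral_congr
  intro t ht
  rw [uIcc_of_le zero_le_one] at ht
  simp only [hπ t ht]

/-- The segment from z to z + ω projects to a closed path along which dw/v pulls back to ω dt. -/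
theorem Uniformizes.subset_periods {P : ℂ[X]} {Λ : Set ℂ} {W V : ℂ → ℂ} {D : Set ℂ}
    (h : Uniformizes P Λ W V D) : Λ ⊆ periods P := by
  intro ω hω
  obtain ⟨z, hz⟩ := exists_line_avoiding h.countable ω
  have hline : ∀ t : ℝ, HasDerivAt (fun t : ℝ => z + t * ω) ω t := fun t => by
    simpa using ((Complex.ofRealCLM.hasDerivAt (x := t)).mul_const ω).const_add z
  have hd : ∀ t : ℝ, HasDerivAt (fun t : ℝ => W (z + t * ω)) (V (z + t * ω) * ω) t := fun t =>
    (h.hasDerivAt _ (hz t)).comp_of_eq t (hline t) rfl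
  have hV : Continuous fun t : ℝ => V (z + t * ω) := continuous_iff_continuousAt.mpr fun t =>
    (h.continuousAt _ (hz t)).comp_of_eq (hline t).continuousAt rfl
  have hderiv : deriv (fun t : ℝ => W (z + t * ω)) = fun t : ℝ => V (z + t * ω) * ω :=
    funext fun t => (hd t).deriv
  have hz0 : z ∉ D := by simpa using hz 0
  refine ⟨fun t => W (z + t * ω), fun t => V (z + t * ω), ?_, hV,
    fun t _ => ⟨h.sq_eq _ (hz t), h.ne_zero _ (hz t)⟩, ?_, ?_, ?_⟩
  · rw [contDiff_one_iff_deriv, hderiv]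
    exact ⟨fun t => (hd t).differentiableAt, hV.mul continuous_const⟩
  · simp [(h.map_add z hz0 ω hω).1]
  · simp [(h.map_add z hz0 ω hω).2]
  · rw [hderiv]
    have : ∀ t : ℝ, V (z + t * ω) * ω / V (z + t * ω) = ω := fun t => by
      have := h.ne_zero _ (hz t)
      field_simp
    simp [this]

theorem Uniformizes.periods_eq {P : ℂ[X]} {Λ : Set ℂ} {W V : ℂ → ℂ} {D : Set ℂ}
    (h : Uniformizes P Λ W V D) : periods P = Λ :=
  h.periods_subset.antisymm h.subset_periods

/-- The value of W fixes V up to sign, and each pair (W, V) is attained on at most one translate of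
Λ. A coordinate change may therefore delete countably many values of x and keep the exceptional set
countable. -/
theorem Uniformizes.countable_fiber {P : ℂ[X]} {Λ : Set ℂ} {W V : ℂ → ℂ} {D : Set ℂ}
    (h : Uniformizes P Λ W V D) (hΛ : Λ.Countable) (x : ℂ) : {z | z ∉ D ∧ W z = x}.Countable := by
  obtain ⟨c, hc⟩ := IsAlgClosed.exists_pow_nat_eq (P.eval x) two_pos
  have key : ∀ y, {z | z ∉ D ∧ W z = x ∧ V z = y}.Countable := by
    intro y
    rcases eq_empty_or_nonempty {z | z ∉ D ∧ W z = x ∧ V z = y} with h0 | ⟨z₀, h1, h2, h3⟩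
    · simp [h0]
    · refine (hΛ.image (z₀ + ·)).mono ?_
      rintro z ⟨h4, h5, h6⟩
      exact ⟨z - z₀, h.inj _ h1 _ h4 (h2.trans h5.symm) (h3.trans h6.symm), by simp⟩
  refine ((key c).union (key (-c))).mono ?_
  rintro z ⟨h1, h2⟩
  have := h.sq_eq z h1
  rw [h2, ← hc, sq_eq_sq_iff_eq_or_eq_neg] at this
  exact this.imp (fun e => ⟨h1, h2, e⟩) (fun e => ⟨h1, h2, e⟩)

/-- Change of the coordinate `x` on the curve by an injective map `M` with inverse `N`. -/
theorem Uniformizes.transform {P Q : ℂ[X]} {Λ : Set ℂ} {W V : ℂ → ℂ} {D : Set ℂ}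
    (h : Uniformizes P Λ W V D) (hΛ : Λ.Countable) {s t : Set ℂ} {M M' N : ℂ → ℂ}
    (hs : IsOpen s) (hsc : sᶜ.Countable)
    (hM : ∀ x ∈ s, HasDerivAt M (M' x) x) (hM' : ∀ x ∈ s, ContinuousAt M' x)
    (hM0 : ∀ x ∈ s, M' x ≠ 0) (hNM : ∀ x ∈ s, N (M x) = x)
    (hN : ∀ w ∈ t, N w ∈ s ∧ M (N w) = w ∧ ContinuousAt N w)
    (hQt : ∀ w, Q.eval w ≠ 0 → w ∈ t)
    (hQ : ∀ x ∈ s, Q.eval (M x) = M' x ^ 2 * P.eval x) :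
    Uniformizes Q Λ (M ∘ W) (fun z => M' (W z) * V z) (D ∪ W ⁻¹' sᶜ) := by
  have hmem : ∀ z, z ∉ D ∪ W ⁻¹' sᶜ ↔ z ∉ D ∧ W z ∈ s := by simp
  have hWc : ∀ z ∉ D, ContinuousAt W z := fun z hz => (h.hasDerivAt z hz).continuousAt
  refine ⟨?_, ?_, ?_, ?_, ?_, ?_, ?_, ?_, ?_, ?_, ?_⟩
  · rw [← isOpen_compl_iff]
    have : (D ∪ W ⁻¹' sᶜ)ᶜ = Dᶜ ∩ W ⁻¹' s := by ext z; simp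
    rw [this]
    exact ContinuousOn.isOpen_inter_preimage
      (fun z hz => (hWc z hz).continuousWithinAt) h.isClosed.isOpen_compl hs
  · refine (h.countable.union (hsc.biUnion fun x _ => h.countable_fiber hΛ x)).mono ?_
    rintro z (hz | hz)
    · exact .inl hz
    · by_cases hzD : z ∈ D
      · exact .inl hzD
      · exact .inr (mem_iUnion₂.mpr ⟨W z, hz, hzD, rfl⟩)
  · intro z hz
    rw [hmem] at hz
    exact (hM _ hz.2).comp z (h.hasDerivAt z hz.1)
  · intro z hz
    rw [hmem] at hz
    exact ((hM' _ hz.2).comp (hWc z hz.1)).mul (h.continuousAt z hz.1)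
  · intro z hz
    rw [hmem] at hz
    exact mul_ne_zero (hM0 _ hz.2) (h.ne_zero z hz.1)
  · intro z hz
    rw [hmem] at hz
    rw [mul_pow, h.sq_eq z hz.1, Function.comp_apply, hQ _ hz.2]
  · intro z hz w hw
    obtain ⟨h1, h2, h3⟩ := hN w (hQt w hw)
    have hPx : P.eval (N w) ≠ 0 := fun h0 => hw (by rw [← h2, hQ _ h1, h0, mul_zero])
    -- The exceptional set has gained the points with W z ∉ s. There N w ∈ s differs from W z, and
    -- the Hausdorff property together with continuity of W separates them.
    have key : ∃ U ∈ 𝓝 (N w), ∀ᶠ z' in 𝓝[≠] z, z' ∉ D → W z' ∉ U := by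
      by_cases hzD : z ∈ D
      · exact h.avoids z hzD _ hPx
      · have hzs : W z ∉ s := hz.resolve_left hzD
        have hne : N w ≠ W z := fun e => hzs (e ▸ h1)
        obtain ⟨U, U', hU, hU', hdis⟩ := t2_separation_nhds hne
        refine ⟨U, hU, ?_⟩
        filter_upwards [((hWc z hzD).eventually hU').filter_mono nhdsWithin_le_nhds] with z' hz' _
        exact disjoint_right.mp hdis hz'
    obtain ⟨U, hU, hev⟩ := key
    refine ⟨N ⁻¹' U, h3 hU, hev.mono fun z' hz' hz'D => ?_⟩
    rw [hmem] at hz'D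
    simpa [hNM _ hz'D.2] using hz' hz'D.1
  · intro w v hv hvw
    have hw : Q.eval w ≠ 0 := by rw [← hvw]; exact pow_ne_zero _ hv
    obtain ⟨h1, h2, h3⟩ := hN w (hQt w hw)
    have hm := hM0 _ h1
    obtain ⟨z, hz, hz1, hz2⟩ := h.surj (N w) (v / M' (N w)) (div_ne_zero hv hm)
      (by rw [div_pow, hvw, div_eq_iff (pow_ne_zero _ hm), mul_comm, ← hQ _ h1, h2])
    refine ⟨z, (hmem z).mpr ⟨hz, hz1 ▸ h1⟩, by simp [hz1, h2], ?_⟩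
    simp only [hz1, hz2]
    field_simp
  · intro z hz z' hz' e1 e2
    rw [hmem] at hz hz'
    have e3 : W z = W z' := by
      rw [← hNM _ hz.2, ← hNM _ hz'.2]; exact congrArg N e1
    refine h.inj z hz.1 z' hz'.1 e3 ?_
    simp only [e3] at e2
    exact mul_left_cancel₀ (hM0 _ hz'.2) e2
  · intro z hz l hl
    rw [hmem] at hz ⊢
    exact ⟨h.add_notMem z hz.1 l hl, by rw [(h.map_add z hz.1 l hl).1]; exact hz.2⟩
  · intro z hz l hl
    rw [hmem] at hz
    simp [(h.map_add z hz.1 l hl).1, (h.map_add z hz.1 l hl).2]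

/-- Multiplication of the curve's equation by a constant. -/
theorem Uniformizes.scale {P Q : ℂ[X]} {Λ : Set ℂ} {W V : ℂ → ℂ} {D : Set ℂ}
    (h : Uniformizes P Λ W V D) {κ : ℂ} (hκ : κ ≠ 0) (hQ : ∀ x, Q.eval x = κ ^ 2 * P.eval x) :
    Uniformizes Q {z | κ * z ∈ Λ} (fun z => W (κ * z)) (fun z => κ * V (κ * z))
      {z | κ * z ∈ D} := by
  have hc : Continuous fun z : ℂ => κ * z := continuous_const.mul continuous_id
  have hQP : ∀ x, Q.eval x ≠ 0 → P.eval x ≠ 0 := fun x hx h0 => hx (by rw [hQ, h0, mul_zero])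
  refine ⟨h.isClosed.preimage hc, ?_, ?_, ?_, ?_, ?_, ?_, ?_, ?_, ?_, ?_⟩
  · exact h.countable.preimage_of_injOn (mul_right_injective₀ hκ).injOn
  · intro z hz
    have := (h.hasDerivAt _ hz).comp_of_eq z ((hasDerivAt_id z).const_mul κ) rfl
    rw [mul_one, mul_comm] at this
    exact this
  · intro z hz
    exact continuousAt_const.mul ((h.continuousAt _ hz).comp_of_eq hc.continuousAt rfl)
  · exact fun z hz => mul_ne_zero hκ (h.ne_zero _ hz)
  · intro z hz
    rw [mul_pow, h.sq_eq _ hz, hQ]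
  · intro z hz w hw
    obtain ⟨U, hU, hev⟩ := h.avoids _ hz w (hQP w hw)
    refine ⟨U, hU, ?_⟩
    rw [eventually_nhdsWithin_iff] at hev ⊢
    filter_upwards [hc.continuousAt.eventually hev] with z' hz' hne
    exact hz' fun e => hne (mul_left_cancel₀ hκ e)
  · intro w v hv hvw
    obtain ⟨z, hz, h1, h2⟩ := h.surj w (v / κ) (div_ne_zero hv hκ)
      (by rw [div_pow, hvw, hQ]; field_simp)
    have e : κ * (z / κ) = z := by field_simp
    refine ⟨z / κ, by simpa only [mem_ofPred_eq, e] using hz, by rw [e, h1], ?_⟩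
    rw [e, h2]; field_simp
  · intro z hz z' hz' e1 e2
    have := h.inj _ hz _ hz' e1 (mul_left_cancel₀ hκ e2)
    simpa only [mem_ofPred_eq, mul_sub] using this
  · intro z hz l hl
    have := h.add_notMem _ hz _ hl
    simpa only [mem_ofPred_eq, mul_add] using this
  · intro z hz l hl
    have := h.map_add _ hz _ hl
    simp only [mul_add, this.1, this.2, and_self]

/-- The lattice spanned by two numbers. -/
def latticeSpan (ω₁ ω₂ : ℂ) : Set ℂ := {ω | ∃ m n : ℤ, ω = m * ω₁ + n * ω₂}

theorem countable_latticeSpan (ω₁ ω₂ : ℂ) : (latticeSpan ω₁ ω₂).Countable := by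
  refine (countable_range fun p : ℤ × ℤ => (p.1 * ω₁ + p.2 * ω₂ : ℂ)).mono ?_
  rintro ω ⟨m, n, rfl⟩
  exact ⟨(m, n), rfl⟩

/-- The curve `v ^ 2 = P w` is uniformized by functions with a period lattice of ratio `τ`. -/
def HasUniformization (P : ℂ[X]) (τ : ℍ) : Prop :=
  ∃ ω₁ ω₂ : ℂ, ω₁ ≠ 0 ∧ ω₂ / ω₁ = (τ : ℂ) ∧
    ∃ W V D, Uniformizes P (latticeSpan ω₁ ω₂) W V D

theorem HasUniformization.isPeriodRatio {P : ℂ[X]} {τ : ℍ} (h : HasUniformization P τ) :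
    IsPeriodRatio P τ := by
  obtain ⟨ω₁, ω₂, h1, h2, W, V, D, hU⟩ := h
  exact ⟨ω₁, ω₂, h1, h2, hU.periods_eq⟩

theorem HasUniformization.scale {P Q : ℂ[X]} {τ : ℍ} (h : HasUniformization P τ) {c : ℂ}
    (hc : c ≠ 0) (hQ : ∀ x, Q.eval x = c * P.eval x) : HasUniformization Q τ := by
  obtain ⟨ω₁, ω₂, h1, h2, W, V, D, hU⟩ := h
  obtain ⟨κ, rfl⟩ := IsAlgClosed.exists_pow_nat_eq c two_pos
  have hκ : κ ≠ 0 := fun h0 => hc (by simp [h0])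
  have e : {z | κ * z ∈ latticeSpan ω₁ ω₂} = latticeSpan (ω₁ / κ) (ω₂ / κ) := by
    ext z
    refine exists_congr fun m => exists_congr fun n => ?_
    rw [← mul_right_inj' hκ (b := z)]
    field_simp
  exact ⟨ω₁ / κ, ω₂ / κ, div_ne_zero h1 hκ, by rw [← h2]; field_simp, _, _, _,
    e ▸ hU.scale hκ hQ⟩

/-- If Q ∘ M = c M'² P, then dw/v pulls back to a constant multiple of dx/y. The constant rescales
the lattice and leaves its ratio alone. -/
theorem HasUniformization.transform {P Q : ℂ[X]} {τ : ℍ} (h : HasUniformization P τ)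
    {s t : Set ℂ} {M M' N : ℂ → ℂ}
    (hs : IsOpen s) (hsc : sᶜ.Countable)
    (hM : ∀ x ∈ s, HasDerivAt M (M' x) x) (hM' : ∀ x ∈ s, ContinuousAt M' x)
    (hM0 : ∀ x ∈ s, M' x ≠ 0) (hNM : ∀ x ∈ s, N (M x) = x)
    (hN : ∀ w ∈ t, N w ∈ s ∧ M (N w) = w ∧ ContinuousAt N w)
    (hQt : ∀ w, Q.eval w ≠ 0 → w ∈ t) {c : ℂ} (hc : c ≠ 0)
    (hQ : ∀ x ∈ s, Q.eval (M x) = c * (M' x ^ 2 * P.eval x)) : HasUniformization Q τ := by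
  have h' : HasUniformization (C c * P) τ := h.scale hc (by simp)
  obtain ⟨ω₁, ω₂, h1, h2, W, V, D, hU⟩ := h'
  exact ⟨ω₁, ω₂, h1, h2, _, _, _, hU.transform (countable_latticeSpan _ _) hs hsc hM hM' hM0 hNM hN
    hQt fun x hx => by rw [hQ x hx]; simp; ring⟩

/-- Affine change of coordinate. -/
theorem HasUniformization.affine {P Q : ℂ[X]} {τ : ℍ} (h : HasUniformization P τ) {a b c : ℂ}
    (ha : a ≠ 0) (hc : c ≠ 0) (hQ : ∀ x, Q.eval (a * x + b) = c * P.eval x) :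
    HasUniformization Q τ := by
  refine h.transform (s := univ) (t := univ) (M := fun x => a * x + b) (M' := fun _ => a)
    (N := fun w => (w - b) / a) (c := c / a ^ 2) isOpen_univ (by simp) ?_ ?_ ?_ ?_ ?_ ?_ ?_ ?_
  · intro x _
    simpa using ((hasDerivAt_id x).const_mul a).add_const b
  · exact fun x _ => continuousAt_const
  · exact fun x _ => ha
  · intro x _
    field_simp
    ring
  · refine fun w _ => ⟨mem_univ _, by field_simp; ring, ?_⟩
    fun_prop
  · simp
  · positivity
  · intro x _
    rw [hQ]
    field_simp

/-- The coordinate change `w = (x + 1) / (x - 1)`, from a cubic with the root `0` to a quartic with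
the roots `±1`. -/
theorem HasUniformization.cayley {P Q : ℂ[X]} {τ : ℍ} (h : HasUniformization P τ) {c : ℂ}
    (hc : c ≠ 0) (hQ1 : Q.eval 1 = 0)
    (hQ : ∀ x ≠ 1, Q.eval ((x + 1) / (x - 1)) = c * P.eval x / (x - 1) ^ 4) :
    HasUniformization Q τ := by
  have hx : ∀ x ∈ ({1}ᶜ : Set ℂ), x - 1 ≠ 0 := fun x hx => sub_ne_zero.mpr hx
  -- The Cayley map is an involution, so M = N. Since M'² = 4 / (x - 1)⁴, the factor c becomes c /
  -- 4. The value w = 1, the image of x = ∞, may be left out because it is a root of Q.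
  refine h.transform (s := {1}ᶜ) (t := {1}ᶜ) (M := fun x => (x + 1) / (x - 1))
    (M' := fun x => -2 / (x - 1) ^ 2) (N := fun x => (x + 1) / (x - 1)) (c := c / 4)
    isOpen_compl_singleton (by simp) ?_ ?_ ?_ ?_ ?_ ?_ ?_ ?_
  · intro x h1
    have := hx x h1
    have h2 := ((hasDerivAt_id' x).add_const 1).fun_div ((hasDerivAt_id' x).sub_const 1) this
    rwa [show 1 * (x - 1) - (x + 1) * 1 = -2 by ring] at h2
  · intro x h1
    have := hx x h1
    fun_prop (disch := simpa)
  · intro x h1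
    have := hx x h1
    simp [this]
  · intro x h1
    have := hx x h1
    have e : (x + 1) / (x - 1) - 1 = 2 / (x - 1) := by field_simp; ring
    rw [e]
    field_simp
    ring
  · intro x h1
    have := hx x h1
    have e : (x + 1) / (x - 1) - 1 = 2 / (x - 1) := by field_simp; ring
    refine ⟨?_, ?_, ?_⟩
    · rw [mem_compl_singleton_iff, ← sub_ne_zero, e]
      simp [this]
    · rw [e]
      field_simp
      ring
    · fun_prop (disch := simpa)
  · rintro w hw rfl
    exact hw hQ1
  · simpa using hc
  · intro x h1
    have := hx x h1
    rw [hQ x h1]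
    field_simp
    ring

/-! ### Uniformization by the Weierstrass function -/

section Weierstrass

variable (L : PeriodPair)

theorem hasDerivAt_weierstrassP {z : ℂ} (hz : z ∉ L.lattice) :
    HasDerivAt L.weierstrassP (L.derivWeierstrassP z) z := by
  have h := (L.differentiableOn_weierstrassP.differentiableAt
    (L.isClosed_lattice.isOpen_compl.mem_nhds hz)).hasDerivAt
  rwa [L.deriv_weierstrassP] at h

theorem differentiableAt_derivWeierstrassP {z : ℂ} (hz : z ∉ L.lattice) :
    DifferentiableAt ℂ L.derivWeierstrassP z :=
  L.differentiableOn_derivWeierstrassP.differentiableAt (L.isClosed_lattice.isOpen_compl.mem_nhds hz)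

theorem eventually_notMem_lattice (z : ℂ) : ∀ᶠ z' in 𝓝[≠] z, z' ∉ L.lattice := by
  rw [eventually_nhdsWithin_iff]
  filter_upwards [L.compl_lattice_sdiff_singleton_mem_nhds z] with z' hz' hne hmem
  exact hz' ⟨hmem, hne⟩

theorem countable_lattice : (L.lattice : Set ℂ).Countable :=
  countable_of_Lindelof_of_discrete (X := L.lattice)

theorem tendsto_weierstrassP {z : ℂ} (hz : z ∈ L.lattice) :
    Tendsto L.weierstrassP (𝓝[≠] z) (Bornology.cobounded ℂ) :=
  tendsto_cobounded_of_meromorphicOrderAt_neg (by rw [L.order_weierstrassP z hz]; decide)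

theorem not_tendsto_nhds_weierstrassP {z : ℂ} (hz : z ∈ L.lattice) (c : ℂ) :
    ¬ Tendsto L.weierstrassP (𝓝[≠] z) (𝓝 c) := fun h =>
  not_tendsto_nhds_of_tendsto_atTop
    (tendsto_norm_atTop_iff_cobounded.mpr (tendsto_weierstrassP L hz)) _ h.norm

/-- Liouville: if ℘ omitted w, then 1 / (℘ - w), extended by 0 to the lattice, would be entire and
doubly periodic, hence constant; but it vanishes at 0 and not at ω₁ / 2. -/
theorem weierstrassP_surjective (w : ℂ) : ∃ z, z ∉ L.lattice ∧ L.weierstrassP z = w := by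
  classical
  by_contra! hne
  set g : ℂ → ℂ := fun z => if z ∈ L.lattice then 0 else (L.weierstrassP z - w)⁻¹ with hg
  have hev : ∀ z ∉ L.lattice, g =ᶠ[𝓝 z] fun z => (L.weierstrassP z - w)⁻¹ := fun z hz => by
    filter_upwards [L.isClosed_lattice.isOpen_compl.mem_nhds hz] with z' hz'
    exact if_neg hz'
  have hd : ∀ z ∉ L.lattice, DifferentiableAt ℂ g z := fun z hz =>
    (((hasDerivAt_weierstrassP L hz).differentiableAt.sub_const w).inv
      (sub_ne_zero.mpr (hne z hz))).congr_of_eventuallyEq (hev z hz)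
  have hdiff : Differentiable ℂ g := by
    intro z
    by_cases hz : z ∈ L.lattice
    · refine (Complex.analyticAt_of_differentiable_on_punctured_nhds_of_continuousAt
        ((eventually_notMem_lattice L z).mono hd) ?_).differentiableAt
      rw [continuousAt_iff_punctured_nhds]
      have h0 : g z = 0 := if_pos hz
      rw [h0]
      have h1 : Tendsto (fun z => (L.weierstrassP z - w)⁻¹) (𝓝[≠] z) (𝓝 0) := by
        refine tendsto_inv₀_cobounded.comp ?_
        rw [← tendsto_norm_atTop_iff_cobounded]
        have h2 := tendsto_norm_atTop_iff_cobounded.mpr (tendsto_weierstrassP L hz)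
        refine tendsto_atTop_mono (fun z => norm_sub_norm_le _ _) ?_
        simpa [sub_eq_add_neg] using tendsto_atTop_add_const_right _ (-‖w‖) h2
      refine h1.congr' ?_
      filter_upwards [eventually_notMem_lattice L z] with z' hz'
      exact (if_neg hz').symm
    · exact hd z hz
  have hper : ∀ z l, l ∈ L.lattice → g (z + l) = g z := by
    intro z l hl
    have h1 : z + l ∈ L.lattice ↔ z ∈ L.lattice :=
      ⟨fun h => by simpa using L.lattice.sub_mem h hl, fun h => L.lattice.add_mem h hl⟩
    simp only [hg, h1]
    rw [L.weierstrassP_add_coe z ⟨l, hl⟩]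
  have hconst := hdiff.apply_eq_apply_of_bounded
    (IsZLattice.isCompact_range_of_periodic L.lattice g hdiff.continuous hper).isBounded
    (L.ω₁ / 2) 0
  rw [hg] at hconst
  simp only [L.ω₁_div_two_notMem_lattice, if_false, L.lattice.zero_mem, if_true, inv_eq_zero,
    sub_eq_zero] at hconst
  exact hne _ L.ω₁_div_two_notMem_lattice hconst

theorem isPreconnected_compl_of_countable {s : Set ℂ} (hs : s.Countable) : IsPreconnected sᶜ :=
  (hs.isConnected_compl_of_one_lt_rank (by simp)).isPreconnected

theorem not_eventually_const_weierstrassP {z : ℂ} (hz : z ∉ L.lattice) (c : ℂ) :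
    ¬ ∀ᶠ z' in 𝓝 z, L.weierstrassP z' = c := by
  intro h
  have h1 := L.analyticOnNhd_weierstrassP.eqOn_of_preconnected_of_eventuallyEq
    (analyticOnNhd_const (v := c)) (isPreconnected_compl_of_countable (countable_lattice L))
    (z₀ := z) hz h
  refine not_tendsto_nhds_weierstrassP L L.lattice.zero_mem c (tendsto_const_nhds.congr' ?_)
  filter_upwards [eventually_notMem_lattice L 0] with z' hz'
  exact (h1 hz').symm

/-- `℘'' = 6 ℘ ^ 2 - g₂ / 2`. -/
theorem hasDerivAt_derivWeierstrassP {z : ℂ} (hz : z ∉ L.lattice) :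
    HasDerivAt L.derivWeierstrassP (6 * L.weierstrassP z ^ 2 - L.g₂ / 2) z := by
  suffices h : deriv L.derivWeierstrassP z = 6 * L.weierstrassP z ^ 2 - L.g₂ / 2 by
    rw [← h]; exact (differentiableAt_derivWeierstrassP L hz).hasDerivAt
  -- Differentiate ℘'² = 4 ℘³ - g₂ ℘ - g₃ and cancel 2 ℘'.
  have key : ∀ z ∉ L.lattice, L.derivWeierstrassP z ≠ 0 →
      deriv L.derivWeierstrassP z = 6 * L.weierstrassP z ^ 2 - L.g₂ / 2 := by
    intro z hz h0
    have hP := hasDerivAt_weierstrassP L hz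
    have hP' := (differentiableAt_derivWeierstrassP L hz).hasDerivAt
    have e1 : HasDerivAt (fun z => L.derivWeierstrassP z ^ 2) _ z := hP'.fun_pow 2
    have e2 : HasDerivAt (fun z => 4 * L.weierstrassP z ^ 3 - L.g₂ * L.weierstrassP z - L.g₃) _ z :=
      (((hP.fun_pow 3).const_mul 4).fun_sub (hP.const_mul L.g₂)).sub_const L.g₃
    have e3 : (fun z => L.derivWeierstrassP z ^ 2) =ᶠ[𝓝 z]
        (fun z => 4 * L.weierstrassP z ^ 3 - L.g₂ * L.weierstrassP z - L.g₃) := by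
      filter_upwards [L.isClosed_lattice.isOpen_compl.mem_nhds hz] with z' hz'
      exact L.derivWeierstrassP_sq z' hz'
    have e4 := (e2.congr_of_eventuallyEq e3).unique e1
    apply mul_left_cancel₀ h0
    norm_num at e4
    linear_combination - e4 / 2
  -- A failure at z would persist on a ball by continuity. By `key`, ℘' = 0 on that ball, so ℘ would
  -- be locally constant.
  by_contra hne
  have hc : ContinuousAt (fun z => deriv L.derivWeierstrassP z -
      (6 * L.weierstrassP z ^ 2 - L.g₂ / 2)) z := by
    have h1 := (L.analyticOnNhd_derivWeierstrassP z hz).deriv.continuousAt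
    have h2 := (hasDerivAt_weierstrassP L hz).continuousAt
    fun_prop
  have hev := (hc.eventually_ne (sub_ne_zero.mpr hne)).and
    (L.isClosed_lattice.isOpen_compl.mem_nhds hz)
  obtain ⟨ε, hε, hb⟩ := Metric.eventually_nhds_iff_ball.mp hev
  refine not_eventually_const_weierstrassP L hz (L.weierstrassP z) ?_
  filter_upwards [Metric.ball_mem_nhds z hε] with z' hz'
  have h0 : ∀ x ∈ Metric.ball z ε, HasDerivWithinAt L.weierstrassP 0 (Metric.ball z ε) x := by
    intro x hx
    have hx' := hb x hx
    have h1 := hasDerivAt_weierstrassP L hx'.2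
    have h2 : L.derivWeierstrassP x = 0 := by
      by_contra h3
      exact hx'.1 (sub_eq_zero.mpr (key x hx'.2 h3))
    rw [h2] at h1
    exact h1.hasDerivWithinAt
  have := (convex_ball z ε).norm_image_sub_le_of_norm_hasDerivWithin_le (C := 0) h0 (by simp)
    (Metric.mem_ball_self hε) hz'
  simpa [sub_eq_zero] using this

/-- Points at which `℘` and `℘'` take the same values are congruent modulo the lattice. -/
theorem weierstrassP_injective {z z' : ℂ} (hz : z ∉ L.lattice) (hz' : z' ∉ L.lattice)
    (h : L.weierstrassP z = L.weierstrassP z')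
    (h' : L.derivWeierstrassP z = L.derivWeierstrassP z') : z' - z ∈ L.lattice := by
  by_contra hδ
  -- (℘, ℘') solves an autonomous system with polynomial right-hand side F. Equal initial values at
  -- z and z' therefore give ℘(z + t) = ℘(z' + t) for small real t.
  set F : ℂ × ℂ → ℂ × ℂ := fun p => (p.2, 6 * p.1 ^ 2 - L.g₂ / 2) with hF
  have hFc : ContDiff ℝ 1 F := by fun_prop
  obtain ⟨K, s, hs, hlip⟩ := (hFc.contDiffAt
    (x := (L.weierstrassP z, L.derivWeierstrassP z))).exists_lipschitzOnWith
  have hsol : ∀ ζ ∉ L.lattice, (L.weierstrassP ζ, L.derivWeierstrassP ζ) =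
      (L.weierstrassP z, L.derivWeierstrassP z) →
      ∀ᶠ t : ℝ in 𝓝 0, HasDerivAt (fun t : ℝ =>
        (L.weierstrassP (ζ + t), L.derivWeierstrassP (ζ + t)))
        (F (L.weierstrassP (ζ + t), L.derivWeierstrassP (ζ + t))) t ∧
        (L.weierstrassP (ζ + t), L.derivWeierstrassP (ζ + t)) ∈ s := by
    intro ζ hζ he
    have hline : ∀ t : ℝ, HasDerivAt (fun t : ℝ => ζ + t) 1 t := fun t => by
      simpa using (Complex.ofRealCLM.hasDerivAt (x := t)).const_add ζ
    have hd : ∀ t : ℝ, ζ + t ∉ L.lattice → HasDerivAt (fun t : ℝ =>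
        (L.weierstrassP (ζ + t), L.derivWeierstrassP (ζ + t)))
        (F (L.weierstrassP (ζ + t), L.derivWeierstrassP (ζ + t))) t := by
      intro t ht
      have e1 := (hasDerivAt_weierstrassP L ht).comp_of_eq t (hline t) rfl
      have e2 := (hasDerivAt_derivWeierstrassP L ht).comp_of_eq t (hline t) rfl
      simpa using e1.prodMk e2
    have hl0 : ∀ᶠ t : ℝ in 𝓝 0, ζ + t ∉ L.lattice := by
      have := (hline 0).continuousAt.eventually
        (L.isClosed_lattice.isOpen_compl.mem_nhds (x := ζ + (0 : ℝ)) (by simpa using hζ))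
      exact this
    have hcont := (hd 0 (by simpa using hζ)).continuousAt
    have hs' : ∀ᶠ t : ℝ in 𝓝 0, (L.weierstrassP (ζ + t), L.derivWeierstrassP (ζ + t)) ∈ s := by
      apply hcont
      simpa [he] using hs
    filter_upwards [hl0, hs'] with t h1 h2
    exact ⟨hd t h1, h2⟩
  have huniq := ODE_solution_unique_of_eventually (v := fun _ => F) (s := fun _ => s) (t₀ := 0)
    (Eventually.of_forall fun _ => hlip) (hsol z hz rfl) (hsol z' hz' (by rw [h, h']))
    (by simp [h, h'])
  set δ := z' - z with hδdef
  set U : Set ℂ := ((L.lattice : Set ℂ) ∪ (fun ζ => ζ + δ) ⁻¹' L.lattice)ᶜ with hU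
  have hUmem : ∀ ζ, ζ ∈ U ↔ ζ ∉ L.lattice ∧ ζ + δ ∉ L.lattice := by
    intro ζ
    simp [hU]
  have hUc : IsPreconnected U := isPreconnected_compl_of_countable <| (countable_lattice L).union <|
    (countable_lattice L).preimage (add_left_injective δ)
  have hshift : AnalyticOnNhd ℂ (fun ζ => L.weierstrassP (ζ + δ)) U := fun ζ hζ =>
    (L.analyticOnNhd_weierstrassP (ζ + δ) ((hUmem ζ).mp hζ).2).comp_of_eq
      (analyticAt_id.add analyticAt_const) rfl
  have hzδ : z + δ = z' := by rw [hδdef]; ring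
  have hzU : z ∈ U := (hUmem z).mpr ⟨hz, by rwa [hzδ]⟩
  have hfreq : ∃ᶠ ζ in 𝓝[≠] z, L.weierstrassP ζ = L.weierstrassP (ζ + δ) := by
    have ht : Tendsto (fun t : ℝ => z + (t : ℂ)) (𝓝[≠] 0) (𝓝[≠] z) := by
      refine tendsto_nhdsWithin_iff.mpr ⟨?_, ?_⟩
      · have : Continuous fun t : ℝ => z + (t : ℂ) := by fun_prop
        simpa using (this.tendsto 0).mono_left nhdsWithin_le_nhds
      · filter_upwards [self_mem_nhdsWithin] with t ht
        simpa using ht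
    refine ht.frequently (Eventually.frequently ?_)
    filter_upwards [huniq.filter_mono nhdsWithin_le_nhds] with t ht
    have := congrArg Prod.fst ht
    simp only at this
    rw [this, ← hzδ]
    ring_nf
  -- By the identity theorem ℘(ζ) = ℘(ζ + δ) off two translates of the lattice. As ζ → 0 the left
  -- side has a pole and the right side stays finite, since δ is not in the lattice.
  have heq := (L.analyticOnNhd_weierstrassP.mono fun ζ hζ => ((hUmem ζ).mp hζ).1)
    |>.eqOn_of_preconnected_of_frequently_eq hshift hUc hzU hfreq
  have hδc : Tendsto (fun ζ => L.weierstrassP (ζ + δ)) (𝓝[≠] 0) (𝓝 (L.weierstrassP (0 + δ))) := by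
    have h1 : ContinuousAt L.weierstrassP (0 + δ) := by
      rw [zero_add]; exact (hasDerivAt_weierstrassP L hδ).continuousAt
    have h2 : ContinuousAt (fun ζ => L.weierstrassP (ζ + δ)) 0 :=
      ContinuousAt.comp (f := fun ζ => ζ + δ) h1 (by fun_prop)
    exact h2.mono_left nhdsWithin_le_nhds
  refine not_tendsto_nhds_weierstrassP L L.lattice.zero_mem _ (hδc.congr' ?_)
  have h3 : ∀ᶠ ζ in 𝓝[≠] (0 : ℂ), ζ + δ ∉ L.lattice := by
    have hc : ContinuousAt (fun ζ => ζ + δ) (0 : ℂ) := by fun_prop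
    exact (hc.eventually (L.isClosed_lattice.isOpen_compl.mem_nhds (by simpa using hδ))).filter_mono
      nhdsWithin_le_nhds
  filter_upwards [eventually_notMem_lattice L 0, h3] with ζ h4 h5
  exact (heq ((hUmem ζ).mpr ⟨h4, h5⟩)).symm

/-- As ℘ is even and ℘' odd, a zero of ℘' makes z and -z indistinguishable by (℘, ℘'). Conversely,
oddness and periodicity give ℘'(z) = -℘'(z) at a half-period. -/
theorem derivWeierstrassP_eq_zero_iff {z : ℂ} (hz : z ∉ L.lattice) :
    L.derivWeierstrassP z = 0 ↔ 2 * z ∈ L.lattice := by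
  constructor
  · intro h
    have := weierstrassP_injective L (z := -z) (z' := z) (by simpa using hz) hz (by simp) (by simp [h])
    rwa [sub_neg_eq_add, ← two_mul] at this
  · intro h
    have h1 := L.derivWeierstrassP_sub_coe z ⟨2 * z, h⟩
    rw [show z - (2 * z) = -z by ring, L.derivWeierstrassP_neg, neg_eq_self] at h1
    exact h1

/-- The polynomial of the curve `y ^ 2 = 4 x ^ 3 - g₂ x - g₃`. -/
noncomputable def weierstrassCubic : ℂ[X] := C 4 * X ^ 3 - C L.g₂ * X - C L.g₃

/-- The exceptional set is the half-lattice, made of the poles of ℘ and the zeros of ℘'. At a pole ℘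
tends to infinity, at the other half-periods to a root of the cubic; this is `avoids`. -/
theorem uniformizes_weierstrassP : Uniformizes (weierstrassCubic L) L.lattice L.weierstrassP
    L.derivWeierstrassP {z | 2 * z ∈ L.lattice} := by
  have hL : ∀ z, 2 * z ∉ L.lattice → z ∉ L.lattice := fun z hz h => hz (by
    rw [two_mul]; exact L.lattice.add_mem h h)
  have hc : Continuous fun z : ℂ => 2 * z := by fun_prop
  refine ⟨L.isClosed_lattice.preimage hc, ?_, ?_, ?_, ?_, ?_, ?_, ?_, ?_, ?_, ?_⟩
  · exact (countable_lattice L).preimage (mul_right_injective₀ two_ne_zero)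
  · exact fun z hz => hasDerivAt_weierstrassP L (hL z hz)
  · exact fun z hz => (differentiableAt_derivWeierstrassP L (hL z hz)).continuousAt
  · exact fun z hz h => hz ((derivWeierstrassP_eq_zero_iff L (hL z hz)).mp h)
  · intro z hz
    rw [L.derivWeierstrassP_sq z (hL z hz)]
    simp [weierstrassCubic]
  · intro z hz w hw
    by_cases hzL : z ∈ L.lattice
    · have h1 := (tendsto_weierstrassP L hzL).eventually
        (Bornology.isBounded_def.mp (Metric.isBounded_ball (x := w) (r := 1)))
      exact ⟨Metric.ball w 1, Metric.ball_mem_nhds w one_pos, h1.mono fun z' hz' _ => hz'⟩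
    · have hne : w ≠ L.weierstrassP z := by
        rintro rfl
        apply hw
        have h1 := L.derivWeierstrassP_sq z hzL
        rw [(derivWeierstrassP_eq_zero_iff L hzL).mpr hz] at h1
        simp only [weierstrassCubic, eval_sub, eval_mul, eval_C, eval_pow, eval_X]
        rw [← h1]; simp
      obtain ⟨U, U', hU, hU', hdis⟩ := t2_separation_nhds hne
      refine ⟨U, hU, ?_⟩
      filter_upwards [((hasDerivAt_weierstrassP L hzL).continuousAt.eventually hU').filter_mono
        nhdsWithin_le_nhds] with z' hz' _
      exact disjoint_right.mp hdis hz'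
  · intro w v hv hvw
    obtain ⟨z, hz, rfl⟩ := weierstrassP_surjective L w
    have h1 := L.derivWeierstrassP_sq z hz
    simp only [weierstrassCubic, eval_sub, eval_mul, eval_C, eval_pow, eval_X] at hvw
    rw [← hvw, sq_eq_sq_iff_eq_or_eq_neg] at h1
    have h2 : 2 * z ∉ L.lattice := by
      rw [← derivWeierstrassP_eq_zero_iff L hz]
      rcases h1 with h1 | h1 <;> simp [h1, hv]
    rcases h1 with h1 | h1
    · exact ⟨z, h2, rfl, h1⟩
    · refine ⟨-z, ?_, by simp, by simp [h1]⟩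
      simpa using h2
  · exact fun z hz z' hz' h h' => weierstrassP_injective L (hL z hz) (hL z' hz') h h'
  · intro z hz l hl hmem
    refine hz ?_
    have : 2 * (z + l) - (l + l) ∈ L.lattice :=
      L.lattice.sub_mem hmem (L.lattice.add_mem hl hl)
    rwa [show 2 * (z + l) - (l + l) = 2 * z by ring] at this
  · exact fun z _ l hl => ⟨L.weierstrassP_add_coe z ⟨l, hl⟩, L.derivWeierstrassP_add_coe z ⟨l, hl⟩⟩

theorem hasUniformization_weierstrassCubic {τ : ℍ} (hτ : L.ω₂ / L.ω₁ = (τ : ℂ)) :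
    HasUniformization (weierstrassCubic L) τ := by
  have h : latticeSpan L.ω₁ L.ω₂ = L.lattice := by
    ext z
    simp only [latticeSpan, mem_ofPred_eq, SetLike.mem_coe, PeriodPair.mem_lattice, eq_comm]
  refine ⟨L.ω₁, L.ω₂, fun h0 => ?_, hτ, _, _, _, h ▸ uniformizes_weierstrassP L⟩
  simpa [h0] using L.ω₁_div_two_notMem_lattice

end Weierstrass

/-! ### Real elliptic integrals -/

/-- The integral of `dx / √(q x)` over `x > E`. -/
noncomputable def tailIntegral (q : ℝ → ℝ) (E : ℝ) : ENNReal :=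
  ∫⁻ x in Ioi E, ENNReal.ofReal (1 / √(q x))

/-- With values in `ENNReal`, this comparison also carries finiteness from one integrand to another.
-/
theorem tailIntegral_le {q₁ q₂ : ℝ → ℝ} {E k : ℝ} (hk : 0 < k) (h₁ : ∀ x ∈ Ioi E, 0 < q₁ x)
    (h : ∀ x ∈ Ioi E, k * q₁ x ≤ q₂ x) :
    tailIntegral q₂ E ≤ ENNReal.ofReal (1 / √k) * tailIntegral q₁ E := by
  unfold tailIntegral
  rw [← lintegral_const_mul' _ _ ENNReal.ofReal_ne_top]
  refine setLIntegral_mono' measurableSet_Ioi fun x hx => ?_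
  have hq := h₁ x hx
  rw [← ENNReal.ofReal_mul (by positivity), div_mul_div_comm, one_mul, ← Real.sqrt_mul hk.le]
  refine ENNReal.ofReal_le_ofReal ?_
  gcongr
  exact h x hx

theorem tailIntegral_lt {q₁ q₂ : ℝ → ℝ} {E : ℝ} (hc : Continuous q₁)
    (h₁ : ∀ x ∈ Ioi E, 0 < q₁ x) (h : ∀ x ∈ Ioi E, q₁ x < q₂ x) (hfin : tailIntegral q₂ E ≠ ⊤) :
    tailIntegral q₂ E < tailIntegral q₁ E := by
  unfold tailIntegral at *
  have hlt : ∀ x ∈ Ioi E, ENNReal.ofReal (1 / √(q₂ x)) < ENNReal.ofReal (1 / √(q₁ x)) := by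
    intro x hx
    have hq := h₁ x hx
    rw [ENNReal.ofReal_lt_ofReal_iff (by positivity)]
    exact one_div_lt_one_div_of_lt (by positivity) (Real.sqrt_lt_sqrt hq.le (h x hx))
  refine setLIntegral_strict_mono measurableSet_Ioi ?_ ?_ hfin ?_
  · simp
  · have : Measurable fun x => √(q₁ x) := (Real.continuous_sqrt.comp hc).measurable
    exact (measurable_const.div this).ennreal_ofReal
  · exact ae_of_all _ hlt

/-- The time that a decreasing solution of `f' ^ 2 = κ ^ 2 q(f)` takes to come from infinity. -/
theorem tailIntegral_eq {f f' q : ℝ → ℝ} {T κ : ℝ} (hT : 0 < T) (hκ : 0 < κ)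
    (hd : ∀ t ∈ Ioc 0 T, HasDerivAt f (f' t) t) (h0 : ∀ t ∈ Ioo 0 T, f' t ≠ 0)
    (hq : ∀ t ∈ Ioo 0 T, f' t ^ 2 = κ ^ 2 * q (f t)) (hlim : Tendsto f (𝓝[>] 0) atTop) :
    tailIntegral q (f T) = ENNReal.ofReal (κ * T) ∧ ∀ x ∈ Ioi (f T), 0 < q x := by
  have hcont : ContinuousOn f (Ioc 0 T) := fun t ht => (hd t ht).continuousAt.continuousWithinAt
  have hlarge : ∀ y, ∃ t ∈ Ioo 0 T, y < f t := fun y =>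
    ((hlim.eventually (eventually_gt_atTop y)).and (Ioo_mem_nhdsGT hT)).exists.imp
      fun t ht => ⟨ht.2, ht.1⟩
  -- A derivative without zeros has constant sign (Darboux), and an increasing f could not tend to
  -- +∞ at 0⁺.
  have hanti : StrictAntiOn f (Ioc 0 T) := by
    rcases hasDerivWithinAt_forall_lt_or_forall_gt_of_forall_ne (convex_Ioo 0 T)
      (fun t ht => (hd t (Ioo_subset_Ioc_self ht)).hasDerivWithinAt) h0 with h | h
    · refine strictAntiOn_of_deriv_neg (convex_Ioc 0 T) hcont fun t ht => ?_
      rw [interior_Ioc] at ht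
      rw [(hd t (Ioo_subset_Ioc_self ht)).deriv]
      exact h t ht
    · exfalso
      have hmono : StrictMonoOn f (Ioc 0 T) := by
        refine strictMonoOn_of_deriv_pos (convex_Ioc 0 T) hcont fun t ht => ?_
        rw [interior_Ioc] at ht
        rw [(hd t (Ioo_subset_Ioc_self ht)).deriv]
        exact h t ht
      obtain ⟨t, ht, hlt⟩ := hlarge (f T)
      exact (hmono (Ioo_subset_Ioc_self ht) ⟨hT, le_rfl⟩ ht.2).not_gt hlt
  have himage : f '' Ioo 0 T = Ioi (f T) := by
    ext y
    constructor
    · rintro ⟨t, ht, rfl⟩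
      exact hanti (Ioo_subset_Ioc_self ht) ⟨hT, le_rfl⟩ ht.2
    · intro hy
      obtain ⟨t, ht, hlt⟩ := hlarge y
      obtain ⟨s, hs, rfl⟩ := intermediate_value_Ioo' ht.2.le
        (hcont.mono fun s hs => ⟨ht.1.trans_le hs.1, hs.2⟩) ⟨hy, hlt⟩
      exact ⟨s, ⟨ht.1.trans hs.1, hs.2⟩, rfl⟩
  have hqpos : ∀ t ∈ Ioo 0 T, 0 < q (f t) := fun t ht => by
    have := hq t ht ▸ sq_pos_of_ne_zero (h0 t ht)
    exact pos_of_mul_pos_right this (by positivity)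
  refine ⟨?_, ?_⟩
  · unfold tailIntegral
    rw [← himage, lintegral_image_eq_lintegral_abs_deriv_mul measurableSet_Ioo
      (fun t ht => (hd t (Ioo_subset_Ioc_self ht)).hasDerivWithinAt)
      (hanti.injOn.mono Ioo_subset_Ioc_self)]
    -- After the substitution x = f(t) the integrand |f'| / √q(f) is the constant κ.
    have : ∀ t ∈ Ioo 0 T,
        ENNReal.ofReal |f' t| * ENNReal.ofReal (1 / √(q (f t))) = ENNReal.ofReal κ := by
      intro t ht
      have hp := Real.sqrt_pos.mpr (hqpos t ht)
      rw [← ENNReal.ofReal_mul (abs_nonneg _)]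
      congr 1
      rw [← Real.sqrt_sq_eq_abs, hq t ht, Real.sqrt_mul (sq_nonneg κ), Real.sqrt_sq hκ.le]
      field_simp
    rw [setLIntegral_congr_fun measurableSet_Ioo this]
    simp [ENNReal.ofReal_mul hκ.le]
  · rw [← himage]
    rintro _ ⟨t, ht, rfl⟩
    exact hqpos t ht

/-! ### Lattices that are symmetric under complex conjugation -/

theorem tsum_lattice_conj (L : PeriodPair)
    (hL : ∀ l ∈ L.lattice, (starRingEnd ℂ) l ∈ L.lattice) (f : ℂ → ℂ) :
    ∑' l : L.lattice, f ((starRingEnd ℂ) l) = ∑' l : L.lattice, f l := by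
  let e : L.lattice ≃ L.lattice :=
    { toFun := fun l => ⟨(starRingEnd ℂ) l, hL l l.2⟩
      invFun := fun l => ⟨(starRingEnd ℂ) l, hL l l.2⟩
      left_inv := fun l => by simp
      right_inv := fun l => by simp }
  exact e.tsum_eq fun l : L.lattice => f l

theorem weierstrassP_conj (L : PeriodPair) (hL : ∀ l ∈ L.lattice, (starRingEnd ℂ) l ∈ L.lattice)
    (z : ℂ) : L.weierstrassP ((starRingEnd ℂ) z) = (starRingEnd ℂ) (L.weierstrassP z) := by
  simp only [PeriodPair.weierstrassP, Complex.conj_tsum]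
  refine (tsum_lattice_conj L hL fun l => 1 / ((starRingEnd ℂ) z - l) ^ 2 - 1 / l ^ 2).symm.trans ?_
  simp

theorem derivWeierstrassP_conj (L : PeriodPair)
    (hL : ∀ l ∈ L.lattice, (starRingEnd ℂ) l ∈ L.lattice) (z : ℂ) :
    L.derivWeierstrassP ((starRingEnd ℂ) z) = (starRingEnd ℂ) (L.derivWeierstrassP z) := by
  simp only [PeriodPair.derivWeierstrassP, map_neg, Complex.conj_tsum]
  congr 1
  refine (tsum_lattice_conj L hL fun l => 2 / ((starRingEnd ℂ) z - l) ^ 3).symm.trans ?_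
  simp [Complex.conj_ofNat]

/-- On the real and the imaginary axis the Weierstrass function of a lattice that is symmetric under
conjugation inverts a real elliptic integral. -/
theorem tailIntegral_axis (L : PeriodPair) (hL : ∀ l ∈ L.lattice, (starRingEnd ℂ) l ∈ L.lattice)
    {ε : ℂ} (hε : ε = 1 ∨ ε = Complex.I) {T : ℝ} (hT : 0 < T)
    (h2 : ∀ t ∈ Ioo 0 T, 2 * (ε * t) ∉ L.lattice) (hT' : ε * T ∉ L.lattice) {δ r E : ℝ}
    (hδ : 0 < δ) {q : ℝ → ℝ}
    (hq : ∀ x : ℝ, ε ^ 2 * (weierstrassCubic L).eval (ε ^ 2 * (δ * x + r)) = 4 * δ ^ 3 * q x)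
    (hE : L.weierstrassP (ε * T) = ε ^ 2 * (δ * E + r)) :
    tailIntegral q E = ENNReal.ofReal (2 * √δ * T) ∧ ∀ x ∈ Ioi E, 0 < q x := by
  have hε4 : ε ^ 4 = 1 := by rcases hε with rfl | rfl <;> simp
  have hδC : (δ : ℂ) ≠ 0 := by exact_mod_cast hδ.ne'
  have hε0 : ε ≠ 0 := by rcases hε with rfl | rfl <;> simp
  have hε2 : (starRingEnd ℂ) (ε ^ 2) = ε ^ 2 := by rcases hε with rfl | rfl <;> simp
  have hconj : ∀ t : ℝ, (starRingEnd ℂ) (ε * t) = ε * t ∨ (starRingEnd ℂ) (ε * t) = -(ε * t) := by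
    intro t
    rcases hε with rfl | rfl <;> simp
  have hreal : ∀ t : ℝ, (starRingEnd ℂ) (ε ^ 2 * L.weierstrassP (ε * t)) =
      ε ^ 2 * L.weierstrassP (ε * t) := by
    intro t
    rw [map_mul, hε2, ← weierstrassP_conj L hL]
    rcases hconj t with h | h <;> simp [h]
  have hreal' : ∀ t : ℝ, (starRingEnd ℂ) (ε ^ 3 * L.derivWeierstrassP (ε * t)) =
      ε ^ 3 * L.derivWeierstrassP (ε * t) := by
    intro t
    rw [map_mul, ← derivWeierstrassP_conj L hL]
    rcases hε with rfl | rfl <;> simp [Complex.I_pow_three, mul_comm]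
  have hmem : ∀ t ∈ Ioc 0 T, ε * t ∉ L.lattice := by
    intro t ht
    rcases ht.2.eq_or_lt with rfl | hlt
    · exact hT'
    · intro h
      exact h2 t ⟨ht.1, hlt⟩ (by rw [two_mul]; exact L.lattice.add_mem h h)
  -- ε² ℘(ε t) and its t-derivative ε³ ℘'(ε t) are real on the axis. In the coordinate ε² ℘ = δ f +
  -- r the equation of the curve becomes f'² = 4 δ q(f), whence κ = 2 √δ.
  set f : ℝ → ℝ := fun t => ((ε ^ 2 * L.weierstrassP (ε * t)).re - r) / δ with hf
  set f' : ℝ → ℝ := fun t => (ε ^ 3 * L.derivWeierstrassP (ε * t)).re / δ with hf'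
  have hfC : ∀ t : ℝ, ε ^ 2 * L.weierstrassP (ε * t) = δ * f t + r := by
    intro t
    rw [← Complex.conj_eq_iff_re.mp (hreal t)]
    simp only [hf]
    push_cast
    field_simp
    ring
  have hf'C : ∀ t : ℝ, ε ^ 3 * L.derivWeierstrassP (ε * t) = δ * f' t := by
    intro t
    rw [← Complex.conj_eq_iff_re.mp (hreal' t)]
    simp only [hf']
    push_cast
    field_simp
  have hd : ∀ t ∈ Ioc 0 T, HasDerivAt f (f' t) t := by
    intro t ht
    have h1 : HasDerivAt (fun t : ℝ => ε * (t : ℂ)) ε t := by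
      simpa using (Complex.ofRealCLM.hasDerivAt (x := t)).const_mul ε
    have h3 := ((hasDerivAt_weierstrassP L (hmem t ht)).comp_of_eq t h1 rfl).const_mul (ε ^ 2)
    have h4 := (Complex.reCLM.hasFDerivAt.comp_hasDerivAt t h3)
    have h5 := (h4.sub_const r).div_const δ
    have h6 : f' t = Complex.reCLM (ε ^ 2 * (L.derivWeierstrassP (ε * t) * ε)) / δ := by
      simp only [hf', Complex.reCLM_apply]
      congr 2
      ring
    rw [h6]
    exact h5
  have hfT : f T = E := by
    have := hfC T
    rw [hE, ← mul_assoc, ← pow_add, hε4, one_mul] at this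
    have h6 : δ * E + r = δ * f T + r := by exact_mod_cast this
    have h7 : δ * E = δ * f T := by linarith
    exact (mul_left_cancel₀ hδ.ne' h7).symm
  rw [← hfT]
  refine tailIntegral_eq (f' := f') hT (by positivity) hd ?_ ?_ ?_
  · intro t ht h0
    have h1 := hf'C t
    rw [h0, Complex.ofReal_zero, mul_zero, mul_eq_zero] at h1
    exact h2 t ht ((derivWeierstrassP_eq_zero_iff L (hmem t (Ioo_subset_Ioc_self ht))).mp
      (h1.resolve_left (pow_ne_zero _ hε0)))
  · intro t ht
    have h1 := L.derivWeierstrassP_sq _ (hmem t (Ioo_subset_Ioc_self ht))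
    have h3 : ε ^ 2 * (δ * f t + r) = L.weierstrassP (ε * t) := by
      rw [← hfC, ← mul_assoc, ← pow_add, hε4, one_mul]
    have h4 := hq (f t)
    rw [h3] at h4
    simp only [weierstrassCubic, eval_sub, eval_mul, eval_C, eval_pow, eval_X] at h4
    rw [← h1] at h4
    have h5 : (δ * f' t : ℂ) ^ 2 = 4 * δ ^ 3 * q (f t) := by
      rw [← hf'C, ← h4]
      linear_combination ε ^ 2 * L.derivWeierstrassP (ε * t) ^ 2 * hε4
    have h6 : (δ * f' t) ^ 2 = 4 * δ ^ 3 * q (f t) := by exact_mod_cast h5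
    rw [mul_pow, Real.sq_sqrt hδ.le]
    have h7 : δ ^ 2 * f' t ^ 2 = δ ^ 2 * (2 ^ 2 * δ * q (f t)) := by linear_combination h6
    exact mul_left_cancel₀ (by positivity) h7
  -- The polar part is ε² / (ε t)² = 1 / t² for both values of ε, so f tends to +∞ on either axis.
  · have h1 : ∀ t : ℝ, t ≠ 0 → (ε ^ 2 * L.weierstrassP (ε * t)).re =
        (ε ^ 2 * L.weierstrassPExcept 0 (ε * t)).re + (t ^ 2)⁻¹ := by
      intro t ht
      have h := L.weierstrassPExcept_add (0 : L.lattice) (ε * t)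
      simp only [ZeroMemClass.coe_zero, sub_zero, ne_eq, OfNat.ofNat_ne_zero, not_false_eq_true,
        zero_pow, div_zero] at h
      have ht' : (t : ℂ) ≠ 0 := by exact_mod_cast ht
      rw [← h, show ε ^ 2 * (L.weierstrassPExcept 0 (ε * t) + 1 / (ε * t) ^ 2) =
        ε ^ 2 * L.weierstrassPExcept 0 (ε * t) + ((t ^ 2)⁻¹ : ℝ) by push_cast; field_simp,
        Complex.add_re, Complex.ofReal_re]
    have hcont : Tendsto (fun t : ℝ => (ε ^ 2 * L.weierstrassPExcept 0 (ε * t)).re) (𝓝[>] 0)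
        (𝓝 (ε ^ 2 * L.weierstrassPExcept 0 0).re) := by
      have h3 : ContinuousAt (fun t : ℝ => L.weierstrassPExcept 0 (ε * t)) 0 :=
        (L.analyticAt_weierstrassPExcept 0).continuousAt.comp_of_eq
          (f := fun t : ℝ => ε * (t : ℂ)) (by fun_prop) (by simp)
      have h4 : ContinuousAt (fun t : ℝ => (ε ^ 2 * L.weierstrassPExcept 0 (ε * t)).re) 0 :=
        Complex.continuous_re.continuousAt.comp (continuousAt_const.mul h3)
      have h5 := h4.tendsto
      simp only [Complex.ofReal_zero, mul_zero] at h5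
      exact h5.mono_left nhdsWithin_le_nhds
    have hinv : Tendsto (fun t : ℝ => (t ^ 2)⁻¹) (𝓝[>] 0) atTop := by
      refine tendsto_inv_nhdsGT_zero.comp (tendsto_nhdsWithin_iff.mpr ⟨?_, ?_⟩)
      · have : Continuous fun t : ℝ => t ^ 2 := by fun_prop
        simpa using (this.tendsto 0).mono_left nhdsWithin_le_nhds
      · filter_upwards [self_mem_nhdsWithin] with t ht
        exact pow_pos (mem_Ioi.mp ht) 2
    have h6 := ((tendsto_atTop_add_const_right _ (-r) (hcont.add_atTop hinv)).atTop_div_const hδ)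
    refine h6.congr' ?_
    filter_upwards [self_mem_nhdsWithin] with t ht
    rw [hf]
    simp only
    rw [h1 t (ne_of_gt ht), sub_eq_add_neg]

/-! ### Half-period values as the roots of the Weierstrass cubic -/

theorem cubic_eq_of_roots {g₂ g₃ e₁ e₂ e₃ : ℂ} (h12 : e₁ ≠ e₂) (h13 : e₁ ≠ e₃) (h23 : e₂ ≠ e₃)
    (h1 : 4 * e₁ ^ 3 - g₂ * e₁ - g₃ = 0) (h2 : 4 * e₂ ^ 3 - g₂ * e₂ - g₃ = 0)
    (h3 : 4 * e₃ ^ 3 - g₂ * e₃ - g₃ = 0) (x : ℂ) :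
    4 * x ^ 3 - g₂ * x - g₃ = 4 * (x - e₁) * (x - e₂) * (x - e₃) := by
  have a : 4 * (e₁ ^ 2 + e₁ * e₂ + e₂ ^ 2) = g₂ :=
    mul_left_cancel₀ (sub_ne_zero.mpr h12) (by linear_combination h1 - h2)
  have b : 4 * (e₁ ^ 2 + e₁ * e₃ + e₃ ^ 2) = g₂ :=
    mul_left_cancel₀ (sub_ne_zero.mpr h13) (by linear_combination h1 - h3)
  have c : e₁ + e₂ + e₃ = 0 :=
    mul_left_cancel₀ (sub_ne_zero.mpr h23) (by linear_combination (a - b) / 4)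
  obtain rfl : e₃ = -e₁ - e₂ := by linear_combination c
  linear_combination (x - e₁) * a + h1

/-- ℘' vanishes at half-periods, so the values of ℘ there are roots. Two equal values would, as ℘' =
0 at both points, make the half-periods congruent. -/
theorem weierstrassCubic_eval (L : PeriodPair) {z₁ z₂ z₃ : ℂ} (h1 : z₁ ∉ L.lattice)
    (h2 : z₂ ∉ L.lattice) (h3 : z₃ ∉ L.lattice) (h1' : 2 * z₁ ∈ L.lattice)
    (h2' : 2 * z₂ ∈ L.lattice) (h3' : 2 * z₃ ∈ L.lattice) (h12 : z₂ - z₁ ∉ L.lattice)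
    (h13 : z₃ - z₁ ∉ L.lattice) (h23 : z₃ - z₂ ∉ L.lattice) :
    L.weierstrassP z₁ ≠ L.weierstrassP z₂ ∧ L.weierstrassP z₁ ≠ L.weierstrassP z₃ ∧
    L.weierstrassP z₂ ≠ L.weierstrassP z₃ ∧ ∀ x, (weierstrassCubic L).eval x =
      4 * (x - L.weierstrassP z₁) * (x - L.weierstrassP z₂) * (x - L.weierstrassP z₃) := by
  have key : ∀ z, z ∉ L.lattice → 2 * z ∈ L.lattice →
      4 * L.weierstrassP z ^ 3 - L.g₂ * L.weierstrassP z - L.g₃ = 0 := fun z hz hz' => by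
    rw [← L.derivWeierstrassP_sq z hz, (derivWeierstrassP_eq_zero_iff L hz).mpr hz']
    simp
  have hne : ∀ z z', z ∉ L.lattice → 2 * z ∈ L.lattice → z' ∉ L.lattice → 2 * z' ∈ L.lattice →
      z' - z ∉ L.lattice → L.weierstrassP z ≠ L.weierstrassP z' := fun z z' hz hz2 hz' hz2' hd h =>
    hd (weierstrassP_injective L hz hz' h (by
      rw [(derivWeierstrassP_eq_zero_iff L hz).mpr hz2,
        (derivWeierstrassP_eq_zero_iff L hz').mpr hz2']))
  have a := hne _ _ h1 h1' h2 h2' h12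
  have b := hne _ _ h1 h1' h3 h3' h13
  have c := hne _ _ h2 h2' h3 h3' h23
  refine ⟨a, b, c, fun x => ?_⟩
  rw [← cubic_eq_of_roots a b c (key _ h1 h1') (key _ h2 h2') (key _ h3 h3') x]
  simp [weierstrassCubic]

/-! ### Rectangular and rhombic lattices -/

/-- The lattice spanned by `a` and `s a + i b`. -/
noncomputable def realPair (s a b : ℝ) (ha : 0 < a) (hb : 0 < b) : PeriodPair where
  ω₁ := a
  ω₂ := s * a + b * Complex.I
  indep := by
    rw [LinearIndependent.pair_iff]
    intro x y h
    have him := congrArg Complex.im h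
    have hre := congrArg Complex.re h
    simp at him hre
    have hy : y = 0 := him.resolve_right hb.ne'
    subst hy
    simpa [ha.ne'] using hre

theorem mem_realPair_lattice {s a b : ℝ} (ha : 0 < a) (hb : 0 < b) {z : ℂ} :
    z ∈ (realPair s a b ha hb).lattice ↔ ∃ m n : ℤ, z.re = (m + n * s) * a ∧ z.im = n * b := by
  rw [PeriodPair.mem_lattice]
  refine exists_congr fun m => exists_congr fun n => ?_
  rw [eq_comm, Complex.ext_iff]
  simp only [realPair, Complex.add_re, Complex.mul_re, Complex.intCast_re, Complex.intCast_im,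
    Complex.ofReal_re, Complex.ofReal_im, Complex.I_re, Complex.I_im, Complex.add_im,
    Complex.mul_im]
  refine and_congr ?_ ?_ <;> ring_nf

/-- The conjugate of s a + i b is 2 s a - (s a + i b). The cases used are s = 0 and s = 1/2. -/
theorem realPair_conj {s a b : ℝ} (ha : 0 < a) (hb : 0 < b) {k : ℤ} (hk : 2 * s = k) :
    ∀ l ∈ (realPair s a b ha hb).lattice,
      (starRingEnd ℂ) l ∈ (realPair s a b ha hb).lattice := by
  intro l hl
  rw [mem_realPair_lattice] at hl ⊢
  obtain ⟨m, n, h1, h2⟩ := hl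
  refine ⟨m + n * k, -n, ?_, ?_⟩
  · rw [Complex.conj_re, h1]
    push_cast
    rw [← hk]
    ring
  · rw [Complex.conj_im, h2]
    push_cast
    ring

theorem realPair_ratio {s a b : ℝ} (ha : 0 < a) (hb : 0 < b) {τ : ℍ} (hre : τ.re = s)
    (him : τ.im = b / a) :
    (realPair s a b ha hb).ω₂ / (realPair s a b ha hb).ω₁ = (τ : ℂ) := by
  have ha' : (a : ℂ) ≠ 0 := by exact_mod_cast ha.ne'
  have h : (τ : ℂ) = s + (b / a : ℝ) * Complex.I := by
    rw [← hre, ← him]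
    exact (Complex.re_add_im (τ : ℂ)).symm
  rw [h]
  simp only [realPair]
  push_cast
  field_simp

/-- An integer strictly between `0` and `1` does not exist. -/
theorem int_absurd {n : ℤ} {x a : ℝ} (ha : 0 < a) (h : x = n * a) (h0 : 0 < x) (h1 : x < a) :
    False := by
  have h2 : (0 : ℝ) < n := pos_of_mul_pos_left (h ▸ h0) ha.le
  have h3 : (n : ℝ) < 1 := by
    by_contra h4
    nlinarith
  have h5 : 0 < n := by exact_mod_cast h2
  have h6 : n < 1 := by exact_mod_cast h3
  omega

/-- The complete integrals of `dx / √(x (x - 1) (x - m))`. -/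
noncomputable def legendreIntegral (m : ℝ) : ENNReal :=
  tailIntegral (fun x => x * (x - 1) * (x - m)) 1

/-- The complementary integral. -/
noncomputable def legendreIntegral' (m : ℝ) : ENNReal :=
  tailIntegral (fun x => x * (x + 1) * (x + m)) 0

/-- The polynomial `x (x - 1) (x - m)`. -/
noncomputable def legendreCubic (m : ℂ) : ℂ[X] := X * (X - 1) * (X - C m)

/-- The polynomial `x (x ^ 2 - 2 c x + 1)`. -/
noncomputable def reciprocalCubic (c : ℂ) : ℂ[X] := X * (X ^ 2 - C (2 * c) * X + 1)

/-- The complete integral of `dx / √(x (x ^ 2 - 2 c x + 1))`. -/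
noncomputable def reciprocalIntegral (c : ℝ) : ENNReal :=
  tailIntegral (fun x => x * (x ^ 2 - 2 * c * x + 1)) 0

/-- For the lattice ℤ a + ℤ i b the half-period values are real, e₃ < e₂ < e₁. Normalizing by x ↦ (x
- e₃) / (e₁ - e₃) gives m = (e₂ - e₃) / (e₁ - e₃) and κ = √(e₁ - e₃); the two integrals belong to
the segments from 0 to a/2 and from 0 to i b/2. -/
theorem exists_rectangular (a b : ℝ) (ha : 0 < a) (hb : 0 < b) :
    ∃ m κ : ℝ, 0 < m ∧ m < 1 ∧ 0 < κ ∧ legendreIntegral m = ENNReal.ofReal (κ * a) ∧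
      legendreIntegral' m = ENNReal.ofReal (κ * b) ∧
      ∀ τ : ℍ, τ.re = 0 → τ.im = b / a → HasUniformization (legendreCubic m) τ := by
  set L := realPair 0 a b ha hb with hLdef
  have hL := realPair_conj (s := 0) ha hb (k := 0) (by simp)
  rw [← hLdef] at hL
  have hmem : ∀ z : ℂ, z ∈ L.lattice ↔ ∃ m n : ℤ, z.re = m * a ∧ z.im = n * b := fun z => by
    rw [hLdef, mem_realPair_lattice]; simp
  have hre : ∀ z : ℂ, z.re = a / 2 → z ∉ L.lattice := fun z hz h => by
    obtain ⟨m, n, h1, h2⟩ := (hmem z).mp h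
    exact int_absurd ha h1 (by rw [hz]; positivity) (by rw [hz]; linarith)
  have him : ∀ z : ℂ, z.im = b / 2 → z ∉ L.lattice := fun z hz h => by
    obtain ⟨m, n, h1, h2⟩ := (hmem z).mp h
    exact int_absurd hb h2 (by rw [hz]; positivity) (by rw [hz]; linarith)
  set z₁ : ℂ := 1 * (a / 2 : ℝ) with hz₁
  set z₃ : ℂ := Complex.I * (b / 2 : ℝ) with hz₃
  set z₂ : ℂ := z₁ + z₃ with hz₂
  have h1 : z₁ ∉ L.lattice := hre _ (by simp [hz₁])
  have h2 : z₂ ∉ L.lattice := hre _ (by simp [hz₁, hz₂, hz₃])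
  have h3 : z₃ ∉ L.lattice := him _ (by simp [hz₃])
  have h1' : 2 * z₁ ∈ L.lattice := (hmem _).mpr ⟨1, 0, by simp [hz₁]; ring, by simp [hz₁]⟩
  have h3' : 2 * z₃ ∈ L.lattice := (hmem _).mpr ⟨0, 1, by simp [hz₃], by simp [hz₃]; ring⟩
  have h2' : 2 * z₂ ∈ L.lattice := by rw [hz₂, mul_add]; exact L.lattice.add_mem h1' h3'
  obtain ⟨d12, d13, d23, hP⟩ := weierstrassCubic_eval L h1 h2 h3 h1' h2' h3'
    (him _ (by simp [hz₁, hz₂, hz₃])) (him _ (by simp [hz₁, hz₃]))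
    (fun h => h1 (by
      have := L.lattice.neg_mem h
      rwa [hz₂, show -(z₃ - (z₁ + z₃)) = z₁ by ring] at this))
  have hreal : ∀ z, 2 * z ∈ L.lattice → (starRingEnd ℂ) z = z ∨ (starRingEnd ℂ) z = -z ∨
      (starRingEnd ℂ) z = 2 * z₁ - z → ∃ e : ℝ, L.weierstrassP z = e := by
    intro z hz h
    refine ⟨(L.weierstrassP z).re, (Complex.conj_eq_iff_re.mp ?_).symm⟩
    rw [← weierstrassP_conj L hL]
    rcases h with h | h | h
    · rw [h]
    · rw [h, L.weierstrassP_neg]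
    · rw [h, ← L.weierstrassP_neg, neg_sub]
      exact L.weierstrassP_sub_coe z ⟨2 * z₁, h1'⟩
  obtain ⟨e₁, he₁⟩ := hreal z₁ h1' (.inl (by simp [hz₁, Complex.conj_ofNat]))
  obtain ⟨e₃, he₃⟩ := hreal z₃ h3' (.inr (.inl (by simp [hz₃, Complex.conj_ofNat])))
  obtain ⟨e₂, he₂⟩ := hreal z₂ h2' (.inr (.inr (by
    simp [hz₁, hz₂, hz₃, Complex.conj_ofNat]; ring)))
  rw [he₁, he₂] at d12
  rw [he₁, he₃] at d13
  rw [he₂, he₃] at d23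
  rw [he₁, he₂, he₃] at hP
  have hax1 : ∀ t ∈ Ioo 0 (a / 2), 2 * (1 * (t : ℂ)) ∉ L.lattice := fun t ht h => by
    obtain ⟨m, n, h4, h5⟩ := (hmem _).mp h
    simp at h4
    exact int_absurd ha h4 (by linarith [ht.1]) (by linarith [ht.2])
  have hax2 : ∀ t ∈ Ioo 0 (b / 2), 2 * (Complex.I * (t : ℂ)) ∉ L.lattice := fun t ht h => by
    obtain ⟨m, n, h4, h5⟩ := (hmem _).mp h
    simp at h5
    exact int_absurd hb h5 (by linarith [ht.1]) (by linarith [ht.2])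
  -- Here only the positivity statement matters: the cubic has no root above e₁, and on the
  -- imaginary axis none below e₃, which orders the roots.
  have hpos1 := (tailIntegral_axis L hL (.inl rfl) (half_pos ha) hax1 h1 (δ := 1) (r := 0)
    (E := e₁) one_pos (q := fun x => (x - e₁) * (x - e₂) * (x - e₃))
    (by intro x; rw [hP]; push_cast; ring) (by rw [he₁]; simp)).2
  have hpos2 := (tailIntegral_axis L hL (.inr rfl) (half_pos hb) hax2 h3 (δ := 1) (r := 0)
    (E := -e₃) one_pos (q := fun x => (x + e₁) * (x + e₂) * (x + e₃))
    (by intro x; rw [hP, Complex.I_sq]; push_cast; ring) (by rw [he₃]; simp)).2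
  have d12' : e₁ ≠ e₂ := by exact_mod_cast d12
  have d13' : e₁ ≠ e₃ := by exact_mod_cast d13
  have d23' : e₂ ≠ e₃ := by exact_mod_cast d23
  have o12 : e₂ < e₁ := by
    refine lt_of_le_of_ne (le_of_not_gt fun h => ?_) d12'.symm
    simpa using hpos1 e₂ h
  have o23 : e₃ < e₂ := by
    refine lt_of_le_of_ne (le_of_not_gt fun h => ?_) d23'.symm
    simpa using hpos2 (-e₂) (neg_lt_neg h)
  have hδ : 0 < e₁ - e₃ := by linarith
  have hδC : (e₁ : ℂ) - e₃ ≠ 0 := by exact_mod_cast hδ.ne'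
  refine ⟨(e₂ - e₃) / (e₁ - e₃), √(e₁ - e₃), div_pos (by linarith) hδ,
    (div_lt_one hδ).mpr (by linarith), Real.sqrt_pos.mpr hδ, ?_, ?_, ?_⟩
  · have h := (tailIntegral_axis L hL (.inl rfl) (half_pos ha) hax1 h1 (δ := e₁ - e₃) (r := e₃)
      (E := 1) hδ (q := fun x => x * (x - 1) * (x - (e₂ - e₃) / (e₁ - e₃)))
      (by intro x; rw [hP]; push_cast; field_simp; ring) (by rw [he₁]; push_cast; ring)).1
    rw [legendreIntegral, h]
    congr 1
    ring
  · have h := (tailIntegral_axis L hL (.inr rfl) (half_pos hb) hax2 h3 (δ := e₁ - e₃) (r := -e₃)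
      (E := 0) hδ (q := fun x => x * (x + 1) * (x + (e₂ - e₃) / (e₁ - e₃)))
      (by intro x; rw [hP, Complex.I_sq]; push_cast; field_simp; ring)
      (by rw [he₃, Complex.I_sq]; push_cast; ring)).1
    rw [legendreIntegral', h]
    congr 1
    ring
  · intro τ hτ hτ'
    refine (hasUniformization_weierstrassCubic L (realPair_ratio ha hb hτ hτ')).affine
      (a := 1 / (e₁ - e₃)) (b := -e₃ / (e₁ - e₃)) (c := 1 / (4 * (e₁ - e₃) ^ 3))
      (one_div_ne_zero hδC) (one_div_ne_zero (mul_ne_zero (by norm_num) (pow_ne_zero _ hδC))) fun x => ?_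
    rw [hP]
    simp only [legendreCubic, eval_mul, eval_sub, eval_X, eval_one, eval_C]
    push_cast
    field_simp
    ring

/-- For the lattice spanned by a and a/2 + i b, the root e₁ = ℘(a/2) is real and the other two, e₂
and its conjugate, are not. Moving e₁ to 0 and dividing by ρ = |e₂ - e₁| gives c = Re (e₂ - e₁) / ρ
and κ = √ρ. -/
theorem exists_rhombic (a b : ℝ) (ha : 0 < a) (hb : 0 < b) :
    ∃ c κ : ℝ, |c| < 1 ∧ 0 < κ ∧ reciprocalIntegral c = ENNReal.ofReal (κ * a) ∧
      reciprocalIntegral (-c) = ENNReal.ofReal (κ * (2 * b)) ∧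
      ∀ τ : ℍ, τ.re = 1 / 2 → τ.im = b / a → HasUniformization (reciprocalCubic c) τ := by
  set L := realPair (1 / 2) a b ha hb with hLdef
  have hL := realPair_conj (s := 1 / 2) ha hb (k := 1) (by simp)
  rw [← hLdef] at hL
  have hmem : ∀ z : ℂ, z ∈ L.lattice ↔
      ∃ m n : ℤ, z.re = (m + n * (1 / 2)) * a ∧ z.im = n * b := fun z => by
    rw [hLdef, mem_realPair_lattice]
  have him : ∀ z : ℂ, z.im = b / 2 → z ∉ L.lattice := fun z hz h => by
    obtain ⟨m, n, h1, h2⟩ := (hmem z).mp h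
    exact int_absurd hb h2 (by rw [hz]; positivity) (by rw [hz]; linarith)
  have hodd : ∀ z : ℂ, z.re = 0 → z.im = b → z ∉ L.lattice := fun z hz hz' h => by
    obtain ⟨m, n, h1, h2⟩ := (hmem z).mp h
    have hn : (n : ℝ) = 1 := mul_right_cancel₀ hb.ne' (by linarith)
    rw [hz, hn, eq_comm, mul_eq_zero] at h1
    have h3 : (2 * m + 1 : ℝ) = 0 := by linarith [h1.resolve_right ha.ne']
    have h4 : 2 * m + 1 = 0 := by exact_mod_cast h3
    omega
  set z₁ : ℂ := 1 * (a / 2 : ℝ) with hz₁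
  set z₂ : ℂ := (a / 4 : ℝ) + (b / 2 : ℝ) * Complex.I with hz₂
  set z₃ : ℂ := (a / 4 : ℝ) - (b / 2 : ℝ) * Complex.I with hz₃
  have hzb : Complex.I * (b : ℝ) ∉ L.lattice := hodd _ (by simp) (by simp)
  have h1 : z₁ ∉ L.lattice := fun h => by
    obtain ⟨m, n, h4, h5⟩ := (hmem _).mp h
    have hn : (n : ℝ) = 0 := by simpa [hz₁, hb.ne'] using h5
    rw [hn, zero_mul, add_zero] at h4
    exact int_absurd ha h4 (by simp [hz₁, ha]) (by simp [hz₁, ha])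
  have h2 : z₂ ∉ L.lattice := him _ (by simp [hz₂])
  have hneg : ∀ z : ℂ, z.im = -(b / 2) → z ∉ L.lattice := fun z hz h =>
    him (-z) (by rw [Complex.neg_im, hz, neg_neg]) (L.lattice.neg_mem h)
  have h3 : z₃ ∉ L.lattice := hneg _ (by simp [hz₃])
  have h1' : 2 * z₁ ∈ L.lattice := (hmem _).mpr ⟨1, 0, by simp [hz₁]; ring, by simp [hz₁]⟩
  have h2' : 2 * z₂ ∈ L.lattice := (hmem _).mpr ⟨0, 1, by simp [hz₂]; ring, by simp [hz₂]; ring⟩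
  have h3' : 2 * z₃ ∈ L.lattice :=
    (hmem _).mpr ⟨1, -1, by simp [hz₃]; ring, by simp [hz₃]; ring⟩
  obtain ⟨d12, d13, d23, hP⟩ := weierstrassCubic_eval L h1 h2 h3 h1' h2' h3'
    (him _ (by simp [hz₁, hz₂])) (hneg _ (by simp [hz₁, hz₃]))
    (fun h => hodd _ (by simp [hz₂, hz₃]) (by simp [hz₂, hz₃]) (L.lattice.neg_mem h))
  obtain ⟨e₁, he₁⟩ : ∃ e : ℝ, L.weierstrassP z₁ = e :=
    ⟨_, (Complex.conj_eq_iff_re.mp (by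
      rw [← weierstrassP_conj L hL]; simp [hz₁, Complex.conj_ofNat])).symm⟩
  have he₃ : L.weierstrassP z₃ = (starRingEnd ℂ) (L.weierstrassP z₂) := by
    rw [← weierstrassP_conj L hL]
    congr 1
    simp [hz₂, hz₃, sub_eq_add_neg, Complex.conj_ofNat]
  -- The first half-period on the imaginary axis is i b, and it is congruent to -a/2. Both real
  -- integrals thus start at e₁, and x ↦ -x on the imaginary axis replaces c by -c.
  have heb : L.weierstrassP (Complex.I * (b : ℝ)) = e₁ := by
    rw [← he₁, ← L.weierstrassP_neg z₁, ← L.weierstrassP_add_coe (-z₁) ⟨2 * z₂, h2'⟩]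
    congr 1
    simp only [hz₁, hz₂]
    push_cast
    ring
  set e₂ := L.weierstrassP z₂ with he₂
  rw [he₁] at d12 d13
  rw [he₃] at d23
  rw [he₁, he₃] at hP
  have hax1 : ∀ t ∈ Ioo 0 (a / 2), 2 * (1 * (t : ℂ)) ∉ L.lattice := fun t ht h => by
    obtain ⟨m, n, h4, h5⟩ := (hmem _).mp h
    have hn : (n : ℝ) = 0 := by simpa [hb.ne'] using h5
    rw [hn, zero_mul, add_zero] at h4
    simp at h4
    exact int_absurd ha h4 (by linarith [ht.1]) (by linarith [ht.2])
  have hax2 : ∀ t ∈ Ioo 0 b, 2 * (Complex.I * (t : ℂ)) ∉ L.lattice := fun t ht h => by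
    obtain ⟨m, n, h4, h5⟩ := (hmem _).mp h
    simp [ha.ne'] at h4 h5
    have h6 : (2 * m + n : ℝ) = 0 := by linarith
    have h7 : 2 * m + n = 0 := by exact_mod_cast h6
    refine int_absurd (n := -m) hb (x := t) ?_ ht.1 ht.2
    push_cast
    have h8 : (n : ℝ) = -2 * m := by linarith
    rw [h8] at h5
    linarith
  have hbeta : e₂.im ≠ 0 := fun h => d23 (Complex.conj_eq_iff_im.mpr h).symm
  set ρ : ℝ := √((e₂.re - e₁) ^ 2 + e₂.im ^ 2) with hρdef
  have hρ2 : ρ ^ 2 = (e₂.re - e₁) ^ 2 + e₂.im ^ 2 := Real.sq_sqrt (by positivity)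
  have hρ : 0 < ρ := Real.sqrt_pos.mpr (by positivity)
  have hρC : (ρ : ℂ) ≠ 0 := by exact_mod_cast hρ.ne'
  have hρ2C : (ρ : ℂ) ^ 2 = (e₂.re - e₁) ^ 2 + e₂.im ^ 2 := by exact_mod_cast hρ2
  have hP' : ∀ x : ℂ, (weierstrassCubic L).eval (ρ * x + e₁) =
      4 * ρ ^ 3 * (x * (x ^ 2 - 2 * ((e₂.re - e₁) / ρ) * x + 1)) := by
    intro x
    rw [hP]
    have hconj : (starRingEnd ℂ) e₂ = e₂.re - e₂.im * Complex.I := by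
      apply Complex.ext <;> simp
    have hself : e₂ = e₂.re + e₂.im * Complex.I := (Complex.re_add_im e₂).symm
    rw [hconj]
    generalize hre : (e₂.re : ℂ) = α at *
    generalize him' : (e₂.im : ℂ) = β at *
    rw [hself]
    field_simp
    linear_combination (-ρ * x) * hρ2C - ρ * x * β ^ 2 * Complex.I_sq
  refine ⟨(e₂.re - e₁) / ρ, √ρ, ?_, Real.sqrt_pos.mpr hρ, ?_, ?_, ?_⟩
  · rw [abs_div, abs_of_pos hρ, div_lt_one hρ]
    apply abs_lt_of_sq_lt_sq _ hρ.le
    rw [hρ2]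
    have : 0 < e₂.im ^ 2 := by positivity
    linarith
  · have h := (tailIntegral_axis L hL (.inl rfl) (half_pos ha) hax1 h1 (δ := ρ) (r := e₁)
      (E := 0) hρ (q := fun x => x * (x ^ 2 - 2 * ((e₂.re - e₁) / ρ) * x + 1))
      (by intro x; rw [one_pow, one_mul, one_mul, hP']; push_cast; ring)
      (by rw [he₁]; push_cast; ring)).1
    rw [reciprocalIntegral, h]
    congr 1
    ring
  · have h := (tailIntegral_axis L hL (.inr rfl) hb hax2 hzb (δ := ρ) (r := -e₁)
      (E := 0) hρ (q := fun x => x * (x ^ 2 - 2 * (-((e₂.re - e₁) / ρ)) * x + 1))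
      (by
        intro x
        rw [Complex.I_sq, show (-1 : ℂ) * (ρ * x + (-e₁ : ℝ)) = ρ * (-x) + e₁ by push_cast; ring,
          hP']
        push_cast
        ring)
      (by rw [heb, Complex.I_sq]; push_cast; ring)).1
    rw [reciprocalIntegral, h]
    congr 1
    ring
  · intro τ hτ hτ'
    refine (hasUniformization_weierstrassCubic L (realPair_ratio ha hb hτ hτ')).affine
      (a := 1 / ρ) (b := -e₁ / ρ) (c := 1 / (4 * ρ ^ 3))
      (one_div_ne_zero hρC) (one_div_ne_zero (mul_ne_zero (by norm_num) (pow_ne_zero _ hρC))) fun x => ?_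
    have hx : x = ρ * (1 / ρ * x + -e₁ / ρ) + e₁ := by field_simp; ring
    nth_rewrite 2 [hx]
    rw [hP']
    simp only [reciprocalCubic, eval_mul, eval_sub, eval_add, eval_pow, eval_X, eval_one, eval_C]
    push_cast
    field_simp

/-! ### Which cubics have a rectangular or rhombic lattice -/

theorem legendreIntegral_lt {m m' : ℝ} (h1 : m' < 1) (h : m < m')
    (hfin : legendreIntegral m ≠ ⊤) : legendreIntegral m < legendreIntegral m' := by
  refine tailIntegral_lt (by fun_prop) (fun x hx => ?_) (fun x hx => ?_) hfin
  · have hx' : 1 < x := hx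
    exact mul_pos (mul_pos (by linarith) (by linarith)) (by linarith)
  · have hx' : 1 < x := hx
    exact mul_lt_mul_of_pos_left (by linarith) (mul_pos (by linarith) (by linarith))

theorem legendreIntegral'_lt {m m' : ℝ} (h0 : 0 < m) (h : m < m')
    (hfin : legendreIntegral' m' ≠ ⊤) : legendreIntegral' m' < legendreIntegral' m := by
  refine tailIntegral_lt (by fun_prop) (fun x hx => ?_) (fun x hx => ?_) hfin
  · have hx' : 0 < x := hx
    positivity
  · have hx' : 0 < x := hx
    exact mul_lt_mul_of_pos_left (by linarith) (mul_pos (by linarith) (by linarith))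

/-- A crude bound, uniform in x: any two parameters give comparable integrals, so all are finite and
positive as soon as one is. -/
theorem legendreIntegral_le {m m' : ℝ} (h0 : 0 < m) (h1 : m < 1) (h0' : 0 < m') (h1' : m' < 1) :
    legendreIntegral m ≤ ENNReal.ofReal (1 / √(1 - m)) * legendreIntegral m' := by
  refine tailIntegral_le (by linarith) (fun x hx => ?_) (fun x hx => ?_)
  · have hx' : 1 < x := hx
    exact mul_pos (mul_pos (by linarith) (by linarith)) (by linarith)
  · have hx' : 1 < x := hx
    rw [mul_left_comm]
    refine mul_le_mul_of_nonneg_left ?_ (mul_pos (by linarith) (by linarith)).le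
    nlinarith [mul_pos (sub_pos.mpr h1) h0', mul_pos h0 (sub_pos.mpr hx')]

theorem legendreIntegral'_le {m m' : ℝ} (h0 : 0 < m) (h1 : m < 1) (h0' : 0 < m') (h1' : m' < 1) :
    legendreIntegral' m ≤ ENNReal.ofReal (1 / √m) * legendreIntegral' m' := by
  refine tailIntegral_le h0 (fun x hx => ?_) (fun x hx => ?_)
  · have hx' : 0 < x := hx
    positivity
  · have hx' : 0 < x := hx
    rw [mul_left_comm]
    refine mul_le_mul_of_nonneg_left ?_ (mul_pos (by linarith) (by linarith)).le
    nlinarith [mul_pos h0 (sub_pos.mpr h1'), mul_pos hx' (sub_pos.mpr h1)]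

theorem sq_sub_add_one_pos {c x : ℝ} (hc : |c| < 1) : 0 < x ^ 2 - 2 * c * x + 1 := by
  have h := (sq_lt_one_iff_abs_lt_one c).mpr hc
  nlinarith [sq_nonneg (x - c)]

theorem reciprocalIntegral_lt {c c' : ℝ} (h1 : |c'| < 1) (h : c < c')
    (hfin : reciprocalIntegral c ≠ ⊤) : reciprocalIntegral c < reciprocalIntegral c' := by
  refine tailIntegral_lt (by fun_prop) (fun x hx => ?_) (fun x hx => ?_) hfin
  · exact mul_pos hx (sq_sub_add_one_pos h1)
  · have hx' : 0 < x := hx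
    refine mul_lt_mul_of_pos_left ?_ hx'
    nlinarith

theorem reciprocalIntegral_le {c c' : ℝ} (h : |c| < 1) (h' : |c'| < 1) :
    reciprocalIntegral c ≤ ENNReal.ofReal (1 / √((1 - |c|) / 2)) * reciprocalIntegral c' := by
  refine tailIntegral_le (by linarith) (fun x hx => ?_) (fun x hx => ?_)
  · exact mul_pos hx (sq_sub_add_one_pos h')
  · have hx' : 0 < x := hx
    rw [mul_left_comm]
    refine mul_le_mul_of_nonneg_left ?_ hx'.le
    -- Both quadratics are compared with x² + 1.
    have e1 : x ^ 2 - 2 * c' * x + 1 ≤ 2 * (x ^ 2 + 1) := by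
      nlinarith [neg_lt_of_abs_lt h', sq_nonneg (x - 1)]
    have e2 : (1 - |c|) * (x ^ 2 + 1) ≤ x ^ 2 - 2 * c * x + 1 := by
      nlinarith [le_abs_self c, abs_nonneg c, mul_nonneg (abs_nonneg c) (sq_nonneg (x - 1))]
    nlinarith

/-- No integral is ever evaluated: the reference value I comes from the lattice with a = b = 1,
where it is a positive multiple of a side. -/
theorem ne_top_and_ne_zero_of_le {I J : ENNReal} {k k' r : ℝ} (hr : 0 < r)
    (hI : I = ENNReal.ofReal r)
    (h : J ≤ ENNReal.ofReal k * I) (h' : I ≤ ENNReal.ofReal k' * J) :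
    J ≠ ⊤ ∧ 0 < J.toReal ∧ J = ENNReal.ofReal J.toReal := by
  have h1 : J ≠ ⊤ := by
    rw [hI] at h
    exact ne_top_of_le_ne_top (ENNReal.mul_ne_top ENNReal.ofReal_ne_top ENNReal.ofReal_ne_top) h
  refine ⟨h1, ENNReal.toReal_pos ?_ h1, (ENNReal.ofReal_toReal h1).symm⟩
  rintro rfl
  rw [mul_zero, nonpos_iff_eq_zero, hI, ENNReal.ofReal_eq_zero] at h'
  linarith

/-- The point of the upper half plane with given real and imaginary part. -/
theorem exists_upperHalfPlane (x : ℝ) {y : ℝ} (hy : 0 < y) : ∃ τ : ℍ, τ.re = x ∧ τ.im = y :=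
  ⟨UpperHalfPlane.mk ⟨x, y⟩ hy, rfl, rfl⟩

/-- The rectangle whose sides are the two integrals of m belongs to some parameter m₂ whose
integrals are κ times those of m. Opposite monotonicity in the parameter forces m₂ = m. -/
theorem exists_hasUniformization_legendreCubic {m : ℝ} (h0 : 0 < m) (h1 : m < 1) :
    ∃ τ : ℍ, τ.re = 0 ∧ HasUniformization (legendreCubic m) τ := by
  obtain ⟨m₁, κ₁, h0₁, h1₁, hκ₁, hA₁, hB₁, -⟩ := exists_rectangular 1 1 one_pos one_pos
  obtain ⟨hAt, hA, hA'⟩ := ne_top_and_ne_zero_of_le (mul_pos hκ₁ one_pos) hA₁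
    (legendreIntegral_le h0 h1 h0₁ h1₁) (legendreIntegral_le h0₁ h1₁ h0 h1)
  obtain ⟨hBt, hB, hB'⟩ := ne_top_and_ne_zero_of_le (mul_pos hκ₁ one_pos) hB₁
    (legendreIntegral'_le h0 h1 h0₁ h1₁) (legendreIntegral'_le h0₁ h1₁ h0 h1)
  set a := (legendreIntegral m).toReal
  set b := (legendreIntegral' m).toReal
  obtain ⟨m₂, κ, h0₂, h1₂, hκ, hA₂, hB₂, hU⟩ := exists_rectangular a b hA hB
  obtain ⟨τ, hτ, hτ'⟩ := exists_upperHalfPlane 0 (div_pos hB hA)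
  have hm : m₂ = m := by
    -- For m₂ < m the first integral gives κ a < a and the second b < κ b; for m₂ > m both
    -- inequalities are reversed.
    rcases lt_trichotomy m₂ m with h | h | h
    · have e1 := legendreIntegral_lt h1 h (by rw [hA₂]; exact ENNReal.ofReal_ne_top)
      have e2 := legendreIntegral'_lt h0₂ h hBt
      rw [hA₂, hA', ENNReal.ofReal_lt_ofReal_iff hA] at e1
      rw [hB₂, hB', ENNReal.ofReal_lt_ofReal_iff (by positivity)] at e2
      nlinarith
    · exact h
    · have e1 := legendreIntegral_lt h1₂ h hAt
      have e2 := legendreIntegral'_lt h0 h (by rw [hB₂]; exact ENNReal.ofReal_ne_top)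
      rw [hA₂, hA', ENNReal.ofReal_lt_ofReal_iff (by positivity)] at e1
      rw [hB₂, hB', ENNReal.ofReal_lt_ofReal_iff hB] at e2
      nlinarith
  exact ⟨τ, hτ, hm ▸ hU τ hτ hτ'⟩

theorem exists_hasUniformization_reciprocalCubic {c : ℝ} (hc : |c| < 1) :
    ∃ τ : ℍ, τ.re = 1 / 2 ∧ HasUniformization (reciprocalCubic c) τ := by
  have hc' : |-c| < 1 := by rwa [abs_neg]
  obtain ⟨c₁, κ₁, h₁, hκ₁, hA₁, -, -⟩ := exists_rhombic 1 1 one_pos one_pos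
  obtain ⟨hAt, hA, hA'⟩ := ne_top_and_ne_zero_of_le (mul_pos hκ₁ one_pos) hA₁
    (reciprocalIntegral_le hc h₁) (reciprocalIntegral_le h₁ hc)
  obtain ⟨hBt, hB, hB'⟩ := ne_top_and_ne_zero_of_le (mul_pos hκ₁ one_pos) hA₁
    (reciprocalIntegral_le hc' h₁) (reciprocalIntegral_le h₁ hc')
  set a := (reciprocalIntegral c).toReal
  set b := (reciprocalIntegral (-c)).toReal
  -- The imaginary integral of a rhombic lattice is κ (2 b), hence the half.
  obtain ⟨c₂, κ, h₂, hκ, hA₂, hB₂, hU⟩ := exists_rhombic a (b / 2) hA (half_pos hB)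
  have h₂' : |-c₂| < 1 := by rwa [abs_neg]
  rw [mul_div_cancel₀ b two_ne_zero] at hB₂
  obtain ⟨τ, hτ, hτ'⟩ := exists_upperHalfPlane (1 / 2) (div_pos (half_pos hB) hA)
  have hm : c₂ = c := by
    rcases lt_trichotomy c₂ c with h | h | h
    · have e1 := reciprocalIntegral_lt hc h (by rw [hA₂]; exact ENNReal.ofReal_ne_top)
      have e2 := reciprocalIntegral_lt h₂' (neg_lt_neg h) hBt
      rw [hA₂, hA', ENNReal.ofReal_lt_ofReal_iff hA] at e1
      rw [hB₂, hB', ENNReal.ofReal_lt_ofReal_iff (by positivity)] at e2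
      nlinarith
    · exact h
    · have e1 := reciprocalIntegral_lt h₂ h hAt
      have e2 := reciprocalIntegral_lt hc' (neg_lt_neg h)
        (by rw [hB₂]; exact ENNReal.ofReal_ne_top)
      rw [hA₂, hA', ENNReal.ofReal_lt_ofReal_iff (by positivity)] at e1
      rw [hB₂, hB', ENNReal.ofReal_lt_ofReal_iff hB] at e2
      nlinarith
  exact ⟨τ, hτ, hm ▸ hU τ hτ hτ'⟩

theorem exists_reciprocalCubic_of_re_eq_half {τ : ℍ} (hτ : τ.re = 1 / 2) :
    ∃ c : ℝ, |c| < 1 ∧ HasUniformization (reciprocalCubic c) τ := by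
  obtain ⟨c, κ, hc, -, -, -, hU⟩ := exists_rhombic 1 τ.im one_pos τ.im_pos
  exact ⟨c, hc, hU τ hτ (by simp)⟩

/-- For 2 c = p + 1/p the roots are 0, p, 1/p; division by p turns them into 0, 1, 1/p². -/
theorem HasUniformization.reciprocalCubic_of_legendreCubic {p : ℝ} (hp : 1 < p) {τ : ℍ}
    (h : HasUniformization (legendreCubic (1 / p ^ 2 : ℝ)) τ) :
    HasUniformization (reciprocalCubic ((p + 1 / p) / 2 : ℝ)) τ := by
  have hp0 : (p : ℂ) ≠ 0 := by
    have : p ≠ 0 := by positivity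
    exact_mod_cast this
  refine h.affine (a := p) (b := 0) (c := p ^ 3) hp0 (pow_ne_zero _ hp0) fun x => ?_
  simp only [reciprocalCubic, legendreCubic, eval_mul, eval_sub, eval_add, eval_pow, eval_X,
    eval_one, eval_C]
  push_cast
  field_simp
  ring

theorem exists_hasUniformization_reciprocalCubic_of_one_lt {p : ℝ} (hp : 1 < p) :
    ∃ τ : ℍ, τ.re = 0 ∧ HasUniformization (reciprocalCubic ((p + 1 / p) / 2 : ℝ)) τ := by
  have hp2 : 1 < p ^ 2 := one_lt_pow₀ hp two_ne_zero
  obtain ⟨τ, hτ, h⟩ := exists_hasUniformization_legendreCubic (m := 1 / p ^ 2) (by positivity)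
    ((div_lt_one (by positivity)).mpr hp2)
  exact ⟨τ, hτ, h.reciprocalCubic_of_legendreCubic hp⟩

theorem exists_reciprocalCubic_of_re_eq_zero {τ : ℍ} (hτ : τ.re = 0) :
    ∃ p : ℝ, 1 < p ∧ HasUniformization (reciprocalCubic ((p + 1 / p) / 2 : ℝ)) τ := by
  obtain ⟨m, κ, h0, h1, -, -, -, hU⟩ := exists_rectangular 1 τ.im one_pos τ.im_pos
  have hs : 0 < √m := Real.sqrt_pos.mpr h0
  have hs1 : √m < 1 := by rw [Real.sqrt_lt' one_pos]; simpa
  refine ⟨1 / √m, (one_lt_div hs).mpr hs1,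
    HasUniformization.reciprocalCubic_of_legendreCubic ((one_lt_div hs).mpr hs1) ?_⟩
  have : 1 / (1 / √m) ^ 2 = m := by
    rw [div_pow, Real.sq_sqrt h0.le]
    field_simp
  rw [this]
  exact hU τ hτ (by simp)

theorem HasUniformization.reciprocalCubic_neg {c : ℂ} {τ : ℍ}
    (h : HasUniformization (reciprocalCubic c) τ) : HasUniformization (reciprocalCubic (-c)) τ := by
  refine h.affine (a := -1) (b := 0) (c := -1) (by simp) (by simp) fun x => ?_
  simp only [reciprocalCubic, eval_mul, eval_sub, eval_add, eval_pow, eval_X, eval_one, eval_C]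
  ring

/-! ### Period ratios modulo the modular group -/

/-- The two base changes are mutually inverse integer matrices, so their determinants are ±1. The
sign is + because both ratios lie in the upper half plane. -/
theorem toQuotient_eq_of_latticeSpan_eq {τ τ' : ℍ} {ω₁ ω₂ ω₁' ω₂' : ℂ} (h1 : ω₁ ≠ 0)
    (h1' : ω₁' ≠ 0) (hτ : ω₂ / ω₁ = (τ : ℂ)) (hτ' : ω₂' / ω₁' = (τ' : ℂ))
    (h : latticeSpan ω₁ ω₂ = latticeSpan ω₁' ω₂') : toQuotient τ' = toQuotient τ := by
  have hmem₁ : ω₁ ∈ latticeSpan ω₁ ω₂ := ⟨1, 0, by simp⟩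
  have hmem₂ : ω₂ ∈ latticeSpan ω₁ ω₂ := ⟨0, 1, by simp⟩
  have hmem₁' : ω₁' ∈ latticeSpan ω₁' ω₂' := ⟨1, 0, by simp⟩
  have hmem₂' : ω₂' ∈ latticeSpan ω₁' ω₂' := ⟨0, 1, by simp⟩
  rw [h] at hmem₁ hmem₂
  rw [← h] at hmem₁' hmem₂'
  rw [div_eq_iff h1] at hτ
  rw [div_eq_iff h1'] at hτ'
  obtain ⟨d', c', e1⟩ := hmem₁
  obtain ⟨b', a', e2⟩ := hmem₂
  obtain ⟨d, c, e1'⟩ := hmem₁'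
  obtain ⟨b, a, e2'⟩ := hmem₂'
  have him : (τ : ℂ).im ≠ 0 := τ.im_ne_zero
  have hind : ∀ m n : ℤ, (m + n * (τ : ℂ)) * ω₁ = 0 → m = 0 ∧ n = 0 := by
    intro m n h0
    have h2 := (mul_eq_zero.mp h0).resolve_right h1
    have h3 := congrArg Complex.im h2
    have h4 := congrArg Complex.re h2
    simp only [Complex.add_im, Complex.mul_im, Complex.intCast_im, Complex.intCast_re, zero_mul,
      add_zero, zero_add, Complex.zero_im, Complex.add_re, Complex.mul_re, Complex.zero_re,
      mul_eq_zero] at h3 h4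
    have hn : (n : ℝ) = 0 := h3.resolve_right him
    rw [hn] at h4
    refine ⟨by simpa using h4, by exact_mod_cast hn⟩
  rw [hτ] at e2 e1' e2'
  have r1 := hind (d' * d + c' * b - 1) (d' * c + c' * a) (by
    push_cast
    rw [e1', e2'] at e1
    linear_combination -e1)
  have r2 := hind (b' * d + a' * b) (b' * c + a' * a - 1) (by
    push_cast
    rw [e1', e2'] at e2
    linear_combination -e2)
  have hdet : (d' * a' - c' * b') * (a * d - b * c) = 1 := by
    obtain ⟨r11, r12⟩ := r1
    obtain ⟨r21, r22⟩ := r2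
    linear_combination (b' * c + a' * a) * r11 + r22 - (b' * d + a' * b) * r12
  have hne : (c : ℂ) * τ + d ≠ 0 := by
    intro h0
    apply h1'
    rw [e1']
    linear_combination ω₁ * h0
  have hmob : (τ' : ℂ) * (c * τ + d) = a * τ + b := by
    apply mul_right_cancel₀ h1
    rw [hτ', e1'] at e2'
    linear_combination e2'
  -- Im τ' · |c τ + d|² = (a d - b c) Im τ.
  have hpos : 0 < a * d - b * c := by
    have h3 : (τ' : ℂ) * Complex.normSq (c * τ + d) =
        (a * τ + b) * (starRingEnd ℂ) (c * τ + d) := by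
      rw [← hmob, Complex.normSq_eq_conj_mul_self]
      ring
    have h4 := congrArg Complex.im h3
    simp only [Complex.mul_im, Complex.ofReal_re, Complex.ofReal_im, mul_zero, zero_add,
      Complex.add_re, Complex.add_im, Complex.mul_re, Complex.intCast_re, Complex.intCast_im,
      zero_mul, sub_zero, add_zero, Complex.conj_re, Complex.conj_im] at h4
    have h5 : 0 < (τ' : ℂ).im * Complex.normSq (c * τ + d) :=
      mul_pos τ'.im_pos (Complex.normSq_pos.mpr hne)
    rw [h4] at h5
    have h6 : (0 : ℝ) < (a * d - b * c) * (τ : ℂ).im := by linarith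
    have h7 : (0 : ℝ) < a * d - b * c := pos_of_mul_pos_left h6 τ.im_pos.le
    exact_mod_cast h7
  have hdet1 : a * d - b * c = 1 := by
    rcases Int.isUnit_iff.mp (IsUnit.of_mul_eq_one_right _ hdet) with h3 | h3
    · exact h3
    · omega
  obtain ⟨g, hg⟩ : ∃ g : SL(2, ℤ), (g : Matrix (Fin 2) (Fin 2) ℤ) = !![a, b; c, d] :=
    ⟨⟨!![a, b; c, d], by rw [Matrix.det_fin_two_of]; exact hdet1⟩, rfl⟩
  have hgτ : g • τ = τ' := by
    apply UpperHalfPlane.ext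
    rw [UpperHalfPlane.coe_specialLinearGroup_apply, hg, div_eq_iff (by simpa using hne)]
    simpa using hmob.symm
  exact Quotient.sound ⟨g, hgτ⟩

theorem IsPeriodRatio.toQuotient_eq {P : ℂ[X]} {τ τ' : ℍ} (h : IsPeriodRatio P τ)
    (h' : IsPeriodRatio P τ') : toQuotient τ' = toQuotient τ := by
  obtain ⟨ω₁, ω₂, h1, h2, h3⟩ := h
  obtain ⟨ω₁', ω₂', h1', h2', h3'⟩ := h'
  exact toQuotient_eq_of_latticeSpan_eq h1 h1' h2 h2' (h3.symm.trans h3')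

/-! ### Existence and classification of elasticas -/

theorem cubic_eval {e : Fin 3 → ℂ} {a b c : Fin 3} (hab : a ≠ b) (hac : a ≠ c) (hbc : b ≠ c)
    (x : ℂ) : (cubic e).eval x = (x - e a) * (x - e b) * (x - e c) := by
  have h : (Finset.univ : Finset (Fin 3)) = {a, b, c} := by
    revert a b c; decide
  rw [cubic, eval_prod, h, Finset.prod_insert (by simp [hab, hac]), Finset.prod_insert (by simp [hbc]),
    Finset.prod_singleton]
  simp [mul_assoc]

theorem cubic_derivative_eval {e : Fin 3 → ℂ} {a b c : Fin 3} (hab : a ≠ b) (hac : a ≠ c)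
    (hbc : b ≠ c) (x : ℂ) : (cubic e).derivative.eval x =
      (x - e b) * (x - e c) + (x - e a) * (x - e c) + (x - e a) * (x - e b) := by
  have h : cubic e = (X - C (e a)) * (X - C (e b)) * (X - C (e c)) := by
    refine Polynomial.funext fun x => ?_
    rw [cubic_eval hab hac hbc]
    simp
  rw [h]
  simp [derivative_mul]
  ring

/-- The branch points of a curve that carries an elastica. -/
theorem IsGenusOneElastica.mul_eq_one {Z : ℝ → ℂ} {e : Fin 3 → ℂ} {a b c : Fin 3} (hab : a ≠ b)
    (hac : a ≠ c) (hbc : b ≠ c) (h : IsGenusOneElastica Z e a) :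
    (e b - e a) * (e c - e a) = 1 ∧ ∃ s : ℝ, (e b - e a) + (e c - e a) = s ∧ -2 < s ∧ s ≠ 2 := by
  obtain ⟨hinj, ⟨φ, hφ, hZ, -⟩, x, y, hxy⟩ := h
  set p := e b - e a with hp
  set q := e c - e a with hq
  have hpq : p ≠ q := fun h0 => hbc (hinj (by linear_combination h0))
  set E : ℝ → ℂ := fun u => Complex.exp (φ u * Complex.I) with hE
  have hE0 : ∀ u, E u ≠ 0 := fun u => Complex.exp_ne_zero _
  have hxE : ∀ u, x u = E u + e a := fun u => by
    have h1 : E u = x u - e a := (hZ u).unique (hxy u).2.2.2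
    rw [h1]; ring
  have hφ1 : ∀ u, HasDerivAt φ (deriv φ u) u := fun u =>
    (hφ.differentiable (by norm_num) u).hasDerivAt
  have hφ2 : ∀ u, HasDerivAt (deriv φ) (deriv (deriv φ) u) u := fun u => by
    have h2 : ContDiff ℝ 2 (deriv φ) := by
      have : ContDiff ℝ (2 + 1) φ := by norm_num; exact hφ
      exact (contDiff_succ_iff_deriv.mp this).2.2
    exact (h2.differentiable (by norm_num) u).hasDerivAt
  have hEd : ∀ u, HasDerivAt E (E u * (((deriv φ u : ℝ) : ℂ) * Complex.I)) u := fun u =>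
    ((hφ1 u).ofReal_comp.mul_const Complex.I).cexp
  have hy : ∀ u, y u = E u * (((deriv φ u : ℝ) : ℂ) * Complex.I) / 2 := fun u => by
    have h1 : HasDerivAt x (E u * (((deriv φ u : ℝ) : ℂ) * Complex.I)) u :=
      ((hEd u).add_const (e a)).congr_of_eventuallyEq (Eventually.of_forall hxE)
    rw [h1.unique (hxy u).2.1]
    ring
  have hfirst : ∀ u, ((deriv φ u : ℝ) : ℂ) ^ 2 * E u = -4 * (E u - p) * (E u - q) := fun u => by
    have h1 := (hxy u).1
    rw [cubic_eval hab hac hbc, hy, hxE] at h1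
    apply mul_left_cancel₀ (hE0 u)
    have h2 : (E u + e a - e b) = E u - p := by rw [hp]; ring
    have h3 : (E u + e a - e c) = E u - q := by rw [hq]; ring
    rw [h2, h3] at h1
    linear_combination (-4) * h1 + E u ^ 2 * ((deriv φ u : ℝ) : ℂ) ^ 2 * Complex.I_sq
  have hsecond : ∀ u, ((deriv (deriv φ) u : ℝ) : ℂ) * Complex.I * E u = 2 * (E u ^ 2 - p * q) := fun u => by
    have h1 : HasDerivAt y ((E u * (((deriv φ u : ℝ) : ℂ) * Complex.I) * (((deriv φ u : ℝ) : ℂ) * Complex.I) +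
        E u * (((deriv (deriv φ) u : ℝ) : ℂ) * Complex.I)) / 2) u :=
      (((hEd u).mul ((hφ2 u).ofReal_comp.mul_const Complex.I)).div_const 2).congr_of_eventuallyEq
        (Eventually.of_forall hy)
    have h2 := h1.unique (hxy u).2.2.1
    rw [cubic_derivative_eval hab hac hbc, hxE] at h2
    have h3 : (E u + e a - e b) = E u - p := by rw [hp]; ring
    have h4 : (E u + e a - e c) = E u - q := by rw [hq]; ring
    rw [h3, h4] at h2
    linear_combination 2 * h2 + hfirst u - E u * ((deriv φ u : ℝ) : ℂ) ^ 2 * Complex.I_sq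
  have hEinv : ∀ u, E u * (starRingEnd ℂ) (E u) = 1 := fun u => by
    rw [Complex.mul_conj, Complex.normSq_eq_norm_sq, Complex.norm_exp_ofReal_mul_I]
    simp
  have hEcs : ∀ u, E u = Real.cos (φ u) + Real.sin (φ u) * Complex.I := fun u => by
    simp only [hE]
    rw [Complex.exp_mul_I]
    push_cast
    rfl
  -- If φ' vanished identically, E would be p or q by `hfirst`, and then E² = p q by `hsecond` would
  -- give p = q or E = 0.
  obtain ⟨u₀, hu₀⟩ : ∃ u, deriv φ u ≠ 0 := by
    by_contra! h0
    have h00 : deriv φ = fun _ => 0 := funext h0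
    have h1 := hsecond 0
    have h2 := hfirst 0
    rw [h00] at h1 h2
    simp only [deriv_const', Complex.ofReal_zero, zero_mul, ne_eq, OfNat.ofNat_ne_zero,
      not_false_eq_true, zero_pow] at h1 h2
    rcases mul_eq_zero.mp h2.symm with h3 | h3
    · have h4 : E 0 = p := by linear_combination - h3 / 4
      rw [h4] at h1
      have h5 : p * (p - q) = 0 := by linear_combination -h1 / 2
      rcases mul_eq_zero.mp h5 with h6 | h6
      · exact hE0 0 (h4.trans h6)
      · exact hpq (sub_eq_zero.mp h6)
    · have h4 : E 0 = q := by linear_combination h3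
      rw [h4] at h1
      have h5 : q * (p - q) = 0 := by linear_combination h1 / 2
      rcases mul_eq_zero.mp h5 with h6 | h6
      · exact hE0 0 (h4.trans h6)
      · exact hpq (sub_eq_zero.mp h6)
  -- Dividing `hsecond` by E gives i φ'' = 2 (E - p q Ē), whose left side is imaginary; this is the
  -- vanishing of the real part.
  have hreal : ∀ u, Real.cos (φ u) * (1 - (p * q).re) - Real.sin (φ u) * (p * q).im = 0 := fun u => by
    have h1 : ((deriv (deriv φ) u : ℝ) : ℂ) * Complex.I =
        2 * (E u - p * q * (starRingEnd ℂ) (E u)) := by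
      apply mul_right_cancel₀ (hE0 u)
      linear_combination hsecond u + 2 * (p * q) * hEinv u
    have h2 := congrArg Complex.re h1
    rw [hEcs] at h2
    simp [-Complex.ofReal_cos, -Complex.ofReal_sin] at h2 ⊢
    linarith
  -- Differentiating `hreal` and cancelling φ'(u₀) gives the equation rotated by a right angle; the
  -- two together leave only p q = 1.
  have hreal' : Real.sin (φ u₀) * (1 - (p * q).re) + Real.cos (φ u₀) * (p * q).im = 0 := by
    have h1 := ((hφ1 u₀).cos.mul_const (1 - (p * q).re)).sub ((hφ1 u₀).sin.mul_const (p * q).im)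
    have h2 : HasDerivAt (fun u => Real.cos (φ u) * (1 - (p * q).re) -
        Real.sin (φ u) * (p * q).im) 0 u₀ := by
      simp only [hreal]
      exact hasDerivAt_const _ _
    have h3 := h1.unique h2
    apply mul_left_cancel₀ hu₀
    linarith
  have hcs := Real.cos_sq_add_sin_sq (φ u₀)
  have hre : (p * q).re = 1 := by
    linear_combination (1 - (p * q).re) * hcs - Real.cos (φ u₀) * hreal u₀ -
      Real.sin (φ u₀) * hreal'
  have him : (p * q).im = 0 := by
    linear_combination (-(p * q).im) * hcs - Real.sin (φ u₀) * hreal u₀ +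
      Real.cos (φ u₀) * hreal'
  have hpq1 : p * q = 1 := Complex.ext hre him
  -- With p q = 1, dividing `hfirst` by E gives φ'² = 4 (p + q) - 8 cos φ. At u₀ the term φ'² is
  -- positive, so the sum exceeds -2.
  have hsum : p + q = ((deriv φ u₀) ^ 2 / 4 + 2 * Real.cos (φ u₀) : ℝ) := by
    have h1 : E u₀ + (starRingEnd ℂ) (E u₀) = 2 * Real.cos (φ u₀) := by
      rw [hEcs]
      simp [-Complex.ofReal_cos, -Complex.ofReal_sin]
      ring
    push_cast
    rw [← Complex.ofReal_cos, ← h1]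
    apply mul_left_cancel₀ (hE0 u₀)
    linear_combination hpq1 - hEinv u₀ - hfirst u₀ / 4
  refine ⟨hpq1, _, hsum, ?_, fun h2 => hpq ?_⟩
  · have h1 : 0 < deriv φ u₀ ^ 2 := by positivity
    linarith [Real.neg_one_le_cos (φ u₀)]
  · rw [h2] at hsum
    push_cast at hsum
    have h1 : (p - q) ^ 2 = 0 := by linear_combination (p + q + 2) * hsum - 4 * hpq1
    exact sub_eq_zero.mp (pow_eq_zero_iff two_ne_zero |>.mp h1)

/-- p and q are the roots of the real quadratic t² - s t + 1. Real roots have equal signs, and two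
negative ones with product 1 would have sum at most -2. -/
theorem bothPos_or_conjPair {p q : ℂ} (hpq : p * q = 1) {s : ℝ} (hs : p + q = s) (h2 : -2 < s) :
    BothPos p q ∨ ConjPair p q := by
  have hre := congrArg Complex.re hpq
  have him := congrArg Complex.im hpq
  have hsre := congrArg Complex.re hs
  have hsim := congrArg Complex.im hs
  simp only [Complex.mul_re, Complex.mul_im, Complex.one_re, Complex.one_im, Complex.add_re,
    Complex.add_im, Complex.ofReal_re, Complex.ofReal_im] at hre him hsre hsim
  have hqi : q.im = -p.im := by linarith
  rw [hqi] at hre him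
  have h0 : p.im * (q.re - p.re) = 0 := by linarith
  rcases mul_eq_zero.mp h0 with hp | hp
  · left
    rw [hp] at hre hqi
    simp only [neg_zero, mul_zero, sub_zero] at hre hqi
    have h3 : 0 < p.re := by
      by_contra! h4
      have h5 : p.re < 0 := lt_of_le_of_ne h4 fun h => by rw [h] at hre; linarith
      have h6 : q.re < 0 := by nlinarith
      nlinarith [sq_nonneg (p.re - q.re)]
    exact ⟨hp, hqi, h3, by nlinarith⟩
  · by_cases hpi : p.im = 0
    · left
      rw [hpi] at hre hqi
      simp only [neg_zero, mul_zero, sub_zero] at hre hqi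
      have h3 : 0 < p.re := by
        by_contra! h4
        nlinarith
      exact ⟨hpi, hqi, h3, by linarith⟩
    · right
      refine ⟨Complex.ext ?_ hqi, hpi⟩
      rw [Complex.conj_re]
      linarith

/-- An autonomous differential equation with positive bounded right hand side. -/
theorem exists_solution_of_pos {h : ℝ → ℝ} (hc : Continuous h) (hpos : ∀ x, 0 < h x) {B : ℝ}
    (hB : ∀ x, h x ≤ B) : ∃ G : ℝ → ℝ, ∀ u, HasDerivAt G (h (G u)) u := by
  have hB0 : 0 < B := (hpos 0).trans_le (hB 0)
  have hic : Continuous fun x => (h x)⁻¹ := hc.inv₀ fun x => (hpos x).ne'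
  -- Separation of variables: F is the time as a function of position. As 1/h ≥ 1/B, it maps onto ℝ,
  -- and the solution is its inverse.
  set F : ℝ → ℝ := fun x => ∫ t in (0 : ℝ)..x, (h t)⁻¹ with hF
  have hd : ∀ x, HasDerivAt F (h x)⁻¹ x := fun x => (hic.integral_hasStrictDerivAt 0 x).hasDerivAt
  have hmono : StrictMono F := strictMono_of_hasDerivAt_pos hd fun x => inv_pos.mpr (hpos x)
  have hlin : Monotone fun x => F x - x / B := by
    refine monotone_of_hasDerivAt_nonneg (fun x => (hd x).sub ((hasDerivAt_id x).div_const B))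
      fun x => ?_
    have := inv_anti₀ (hpos x) (hB x)
    simpa [sub_nonneg] using this
  have hF0 : F 0 = 0 := by simp [hF]
  have htop : Tendsto F atTop atTop := by
    refine tendsto_atTop_mono' _ ?_ (tendsto_id.atTop_div_const hB0)
    filter_upwards [eventually_ge_atTop 0] with x hx
    have := hlin hx
    simp only [hF0, zero_div, sub_zero] at this
    simpa using this
  have hbot : Tendsto F atBot atBot := by
    refine tendsto_atBot_mono' _ ?_ (tendsto_id.atBot_div_const hB0)
    filter_upwards [eventually_le_atBot 0] with x hx
    have := hlin hx
    simp only [hF0, zero_div, sub_zero] at this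
    simpa using this
  have hFc : Continuous F := continuous_iff_continuousAt.mpr fun x => (hd x).continuousAt
  let e : ℝ ≃o ℝ := StrictMono.orderIsoOfSurjective F hmono (hFc.surjective htop hbot)
  have he : ∀ u, F (e.symm u) = u := fun u => e.apply_symm_apply u
  refine ⟨e.symm, fun u => ?_⟩
  have := HasDerivAt.of_local_left_inverse e.symm.continuous.continuousAt (hd (e.symm u))
    (inv_ne_zero (hpos _).ne') (Eventually.of_forall he)
  rwa [inv_inv] at this

/-- A pendulum motion with the energy that belongs to `s`. -/
theorem exists_pendulum {s : ℝ} (h2 : -2 < s) (hne : s ≠ 2) : ∃ φ ψ : ℝ → ℝ, ∀ u,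
    HasDerivAt φ (ψ u) u ∧ HasDerivAt ψ (4 * Real.sin (φ u)) u ∧
      ψ u ^ 2 = 4 * s - 8 * Real.cos (φ u) := by
  rcases lt_or_gt_of_ne hne with hlt | hgt
  -- For s < 2 the pendulum librates and φ' changes sign. The angle G with cos (φ/2) = κ sin G
  -- satisfies G' = 2 √(1 - κ² sin² G), which is positive because κ < 1.
  · set κ : ℝ := √((s + 2) / 4) with hκ
    have hκ2 : κ ^ 2 = (s + 2) / 4 := Real.sq_sqrt (by linarith)
    have hκ0 : 0 < κ := Real.sqrt_pos.mpr (by linarith)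
    have hrad : ∀ θ : ℝ, 0 < 1 - (κ * Real.sin θ) ^ 2 := fun θ => by
      rw [mul_pow, hκ2]
      nlinarith [Real.sin_sq_le_one θ, sq_nonneg (Real.sin θ)]
    obtain ⟨G, hG⟩ := exists_solution_of_pos (h := fun θ => 2 * √(1 - (κ * Real.sin θ) ^ 2))
      (by fun_prop) (fun θ => mul_pos two_pos (Real.sqrt_pos.mpr (hrad θ))) (B := 2) (fun θ => by
        have : √(1 - (κ * Real.sin θ) ^ 2) ≤ 1 :=
          Real.sqrt_le_one.mpr (by linarith [sq_nonneg (κ * Real.sin θ)])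
        linarith)
    have habs : ∀ θ : ℝ, |κ * Real.sin θ| < 1 := fun θ =>
      (sq_lt_one_iff_abs_lt_one _).mp (by linarith [hrad θ])
    refine ⟨fun u => 2 * Real.arccos (κ * Real.sin (G u)), fun u => -4 * κ * Real.cos (G u),
      fun u => ⟨?_, ?_, ?_⟩⟩
    · have h1 := (Real.hasDerivAt_arccos (neg_lt_of_abs_lt (habs (G u))).ne'
        (lt_of_abs_lt (habs (G u))).ne).comp u ((hG u).sin.const_mul κ)
      have h3 := h1.const_mul 2
      have h4 := (Real.sqrt_pos.mpr (hrad (G u))).ne'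
      have h5 : 2 * (-(1 / √(1 - (κ * Real.sin (G u)) ^ 2)) *
          (κ * (Real.cos (G u) * (2 * √(1 - (κ * Real.sin (G u)) ^ 2))))) =
          -4 * κ * Real.cos (G u) := by
        generalize √(1 - (κ * Real.sin (G u)) ^ 2) = r at h4
        field_simp
        ring
      rw [h5] at h3
      exact h3
    · have h1 := (hG u).cos.const_mul (-4 * κ)
      have h3 : 4 * Real.sin (2 * Real.arccos (κ * Real.sin (G u))) =
          -4 * κ * (-Real.sin (G u) * (2 * √(1 - (κ * Real.sin (G u)) ^ 2))) := by
        rw [Real.sin_two_mul, Real.sin_arccos, Real.cos_arccos (neg_lt_of_abs_lt (habs (G u))).le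
          (lt_of_abs_lt (habs (G u))).le]
        ring
      rw [h3]
      exact h1
    · rw [Real.cos_two_mul, Real.cos_arccos (neg_lt_of_abs_lt (habs (G u))).le
        (lt_of_abs_lt (habs (G u))).le]
      linear_combination (16 * Real.cos (G u) ^ 2 + 16 * Real.sin (G u) ^ 2) * hκ2 +
        (4 * s + 8) * Real.sin_sq_add_cos_sq (G u)
  -- For s > 2 the pendulum rotates and φ' never vanishes.
  · have hrad : ∀ θ : ℝ, 0 < 4 * s - 8 * Real.cos θ := fun θ => by
      linarith [Real.cos_le_one θ]
    obtain ⟨G, hG⟩ := exists_solution_of_pos (h := fun θ => √(4 * s - 8 * Real.cos θ))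
      (by fun_prop) (fun θ => Real.sqrt_pos.mpr (hrad θ)) (B := √(4 * s + 8)) (fun θ =>
        Real.sqrt_le_sqrt (by linarith [Real.neg_one_le_cos θ]))
    refine ⟨G, fun u => √(4 * s - 8 * Real.cos (G u)), fun u => ⟨hG u, ?_, ?_⟩⟩
    · have h1 := (((hG u).cos.const_mul 8).const_sub (4 * s)).sqrt (hrad (G u)).ne'
      have h3 := (Real.sqrt_pos.mpr (hrad (G u))).ne'
      have h4 : -(8 * (-Real.sin (G u) * √(4 * s - 8 * Real.cos (G u)))) /
          (2 * √(4 * s - 8 * Real.cos (G u))) = 4 * Real.sin (G u) := by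
        field_simp
        ring
      rw [h4] at h1
      exact h1
    · exact Real.sq_sqrt (hrad (G u)).le

/-- Existence of an elastica on the curves with suitable branch points. -/
theorem exists_isGenusOneElastica {e : Fin 3 → ℂ} {a b c : Fin 3} (hab : a ≠ b) (hac : a ≠ c)
    (hbc : b ≠ c) (hpq : (e b - e a) * (e c - e a) = 1) {s : ℝ}
    (hs : (e b - e a) + (e c - e a) = s) (h2 : -2 < s) (hne : s ≠ 2) :
    ∃ Z, IsGenusOneElastica Z e a := by
  obtain ⟨φ, ψ, hφψ⟩ := exists_pendulum h2 hne
  have hφ : ∀ u, HasDerivAt φ (ψ u) u := fun u => (hφψ u).1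
  have hψ : ∀ u, HasDerivAt ψ (4 * Real.sin (φ u)) u := fun u => (hφψ u).2.1
  have hφc : Continuous φ := continuous_iff_continuousAt.mpr fun u => (hφ u).continuousAt
  have hdφ : deriv φ = ψ := funext fun u => (hφ u).deriv
  have hdψ : deriv ψ = fun u => 4 * Real.sin (φ u) := funext fun u => (hψ u).deriv
  have hd3 : ∀ u, HasDerivAt (fun u => 4 * Real.sin (φ u)) (4 * (Real.cos (φ u) * ψ u)) u := fun u =>
    (hφ u).sin.const_mul 4
  set E : ℝ → ℂ := fun u => Complex.exp (φ u * Complex.I) with hE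
  have hEd : ∀ u, HasDerivAt E (E u * (ψ u * Complex.I)) u := fun u =>
    ((hφ u).ofReal_comp.mul_const Complex.I).cexp
  have hEc : Continuous E := continuous_iff_continuousAt.mpr fun u => (hEd u).continuousAt
  set Z : ℝ → ℂ := fun u => ∫ t in (0 : ℝ)..u, E t with hZ
  have hZd : ∀ u, HasDerivAt Z (E u) u := fun u => (hEc.integral_hasStrictDerivAt 0 u).hasDerivAt
  have hE0 : ∀ u, E u ≠ 0 := fun u => Complex.exp_ne_zero _
  have hEF : ∀ u, E u * Complex.exp (-(φ u * Complex.I)) = 1 := fun u => by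
    simp only [hE]; rw [← Complex.exp_add]; simp
  have hcos : ∀ u, 2 * (Real.cos (φ u) : ℂ) * E u = E u ^ 2 + 1 := fun u => by
    have h1 := hEF u
    rw [Complex.ofReal_cos, Complex.two_cos, ← neg_mul] at *
    linear_combination h1
  have hsin : ∀ u, 2 * (Real.sin (φ u) : ℂ) * E u * Complex.I = E u ^ 2 - 1 := fun u => by
    have h1 := hEF u
    rw [Complex.ofReal_sin, Complex.two_sin, ← neg_mul] at *
    linear_combination (Complex.exp (-(φ u) * Complex.I) * E u - E u ^ 2) * Complex.I_sq - h1
  have hψ2 : ∀ u, (ψ u : ℂ) ^ 2 = 4 * s - 8 * Real.cos (φ u) := fun u => by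
    exact_mod_cast (hφψ u).2.2
  -- From φ''' = 4 φ' cos φ and φ'² = 4 s - 8 cos φ the elastica equation forces μ = -2 s where φ' ≠
  -- 0. The point on the curve is x = E + e_a, y = E' / 2.
  refine ⟨Z, ?_, ⟨φ, ?_, hZd, -2 * s, fun u => ?_⟩, fun u => E u + e a,
    fun u => E u * (ψ u * Complex.I) / 2, fun u => ⟨?_, ?_, ?_, ?_⟩⟩
  · have h1 : e a ≠ e b := fun h => by rw [h, sub_self, zero_mul] at hpq; simp at hpq
    have h3 : e a ≠ e c := fun h => by rw [h, sub_self, mul_zero] at hpq; simp at hpq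
    have h4 : e b ≠ e c := fun h => by
      rw [h] at hpq hs
      have h5 : (s : ℂ) ^ 2 = 4 := by rw [← hs]; linear_combination 4 * hpq
      have h6 : s ^ 2 = 4 := by exact_mod_cast h5
      rcases (sq_eq_sq_iff_eq_or_eq_neg (b := (2 : ℝ))).mp (by rw [h6]; norm_num) with h7 | h7
      · exact hne h7
      · linarith
    have hall : ∀ a b c : Fin 3, a ≠ b → a ≠ c → b ≠ c → ∀ i, i = a ∨ i = b ∨ i = c := by decide
    replace hall := hall a b c hab hac hbc
    intro i j hij
    rcases hall i with rfl | rfl | rfl <;> rcases hall j with rfl | rfl | rfl <;>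
      first | rfl | exact absurd hij (by assumption) | exact absurd hij.symm (by assumption)
  · have hψ1 : ContDiff ℝ 1 ψ := by
      rw [contDiff_one_iff_deriv, hdψ]
      exact ⟨fun u => (hψ u).differentiableAt, by fun_prop⟩
    have hφ2 : ContDiff ℝ 1 φ := by
      rw [contDiff_one_iff_deriv, hdφ]
      exact ⟨fun u => (hφ u).differentiableAt, hψ1.continuous⟩
    have hψ2 : ContDiff ℝ (1 + 1) ψ := by
      rw [contDiff_succ_iff_deriv, hdψ]
      exact ⟨fun u => (hψ u).differentiableAt, by simp,
        contDiff_const.mul (Real.contDiff_sin.comp hφ2)⟩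
    have hφ3 : ContDiff ℝ (1 + 1 + 1) φ := by
      rw [contDiff_succ_iff_deriv, hdφ]
      exact ⟨fun u => (hφ u).differentiableAt, by simp, hψ2⟩
    norm_num at hφ3
    exact hφ3
  · have h3 : iteratedDeriv 3 φ u = 4 * (Real.cos (φ u) * ψ u) := by
      rw [iteratedDeriv_succ', iteratedDeriv_succ', iteratedDeriv_one, hdφ, hdψ]
      exact (hd3 u).deriv
    rw [h3, hdφ]
    linear_combination ψ u / 2 * (hφψ u).2.2
  · rw [cubic_eval hab hac hbc]
    simp only [add_sub_cancel_right]
    have h1 : (E u + e a - e b) * (E u + e a - e c) = E u ^ 2 - s * E u + 1 := by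
      linear_combination hpq - E u * hs
    rw [mul_assoc, h1]
    linear_combination (E u ^ 2 * ψ u ^ 2 / 4) * Complex.I_sq - E u ^ 2 / 4 * hψ2 u + E u * hcos u
  · have h1 : 2 * (E u * (ψ u * Complex.I) / 2) = E u * (ψ u * Complex.I) := by ring
    rw [h1]
    exact (hEd u).add_const (e a)
  · rw [cubic_derivative_eval hab hac hbc]
    have h1 := ((hEd u).mul ((hψ u).ofReal_comp.mul_const Complex.I)).div_const 2
    have h3 : (E u + e a - e b) * (E u + e a - e c) + (E u + e a - e a) * (E u + e a - e c) +
        (E u + e a - e a) * (E u + e a - e b) = (E u * (ψ u * Complex.I) * (ψ u * Complex.I) +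
          E u * ((4 * Real.sin (φ u) : ℝ) * Complex.I)) / 2 := by
      push_cast
      rw [← Complex.ofReal_sin]
      linear_combination hpq - 2 * E u * hs - hsin u - (E u * ψ u ^ 2 / 2) * Complex.I_sq +
        E u / 2 * hψ2 u - 2 * hcos u
    rw [h3]
    exact h1
  · simp only [add_sub_cancel_right]
    exact hZd u

/-! ### Uniformization of the cubic and of the quartic curve -/

theorem HasUniformization.cubic_of_reciprocalCubic {e : Fin 3 → ℂ} {a b c : Fin 3} (hab : a ≠ b)
    (hac : a ≠ c) (hbc : b ≠ c) (hpq : (e b - e a) * (e c - e a) = 1) {s : ℂ}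
    (hs : (e b - e a) + (e c - e a) = 2 * s) {τ : ℍ} (h : HasUniformization (reciprocalCubic s) τ) :
    HasUniformization (cubic e) τ := by
  refine h.affine (a := 1) (b := e a) (c := 1) one_ne_zero one_ne_zero fun x => ?_
  rw [cubic_eval hab hac hbc]
  simp only [reciprocalCubic, eval_mul, eval_sub, eval_add, eval_pow, eval_X, eval_one, eval_C]
  linear_combination x * hpq - x ^ 2 * hs

/-- For w = (x + 1) / (x - 1) one has 1 - w² = -4 x / (x - 1)² and A + R w² = ((A + R)(x² + 1) - 2
(A - R) x) / (x - 1)². -/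
theorem HasUniformization.quartic_of_reciprocalCubic {p q A R c : ℂ}
    (hA : (Complex.sqrt p - Complex.sqrt q) ^ 2 = A) (hR : 4 * Complex.sqrt (p * q) = R)
    (hAR : A + R ≠ 0) (hc : c = (A - R) / (A + R)) {τ : ℍ}
    (h : HasUniformization (reciprocalCubic c) τ) : HasUniformization (quartic p q) τ := by
  have hc' : c * (A + R) = A - R := by rw [hc]; field_simp
  refine h.cayley (c := -4 * (A + R)) (mul_ne_zero (by norm_num) hAR) (by simp [quartic])
    fun x hx => ?_
  have hx' : x - 1 ≠ 0 := sub_ne_zero.mpr hx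
  rw [quartic, hA, hR]
  simp only [reciprocalCubic, eval_mul, eval_sub, eval_add, eval_pow, eval_X, eval_one, eval_C]
  field_simp
  linear_combination (-8 * x ^ 2) * hc'

theorem exists_hasUniformization_reciprocalCubic_of_one_lt_abs {c : ℝ} (hc : 1 < |c|) :
    ∃ τ : ℍ, τ.re = 0 ∧ HasUniformization (reciprocalCubic c) τ := by
  have key : ∀ d : ℝ, 1 < d → ∃ τ : ℍ, τ.re = 0 ∧ HasUniformization (reciprocalCubic d) τ := by
    intro d hd
    have hr : √(d ^ 2 - 1) ^ 2 = d ^ 2 - 1 := Real.sq_sqrt (by nlinarith)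
    have hr0 := Real.sqrt_nonneg (d ^ 2 - 1)
    have hp : 1 < d + √(d ^ 2 - 1) := by linarith
    obtain ⟨τ, hτ, h⟩ := exists_hasUniformization_reciprocalCubic_of_one_lt hp
    have hp0 : d + √(d ^ 2 - 1) ≠ 0 := by positivity
    have h1 : (d + √(d ^ 2 - 1) + 1 / (d + √(d ^ 2 - 1))) / 2 = d := by
      field_simp
      linear_combination hr
    rw [h1] at h
    exact ⟨τ, hτ, h⟩
  rcases lt_abs.mp hc with h | h
  · exact key c h
  · obtain ⟨τ, hτ, h1⟩ := key (-c) h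
    refine ⟨τ, hτ, ?_⟩
    have h2 := h1.reciprocalCubic_neg
    simpa using h2

/-- Equal signs of A and R give |c| < 1, opposite signs |c| > 1. -/
theorem exists_hasUniformization_quartic_half {p q : ℂ} {A R : ℝ}
    (hA : (Complex.sqrt p - Complex.sqrt q) ^ 2 = A) (hR : 4 * Complex.sqrt (p * q) = R)
    (hA0 : 0 < A) (hR0 : 0 < R) : ∃ τ : ℍ, τ.re = 1 / 2 ∧ HasUniformization (quartic p q) τ := by
  have hc : |(A - R) / (A + R)| < 1 := by
    rw [abs_lt, lt_div_iff₀ (by linarith), div_lt_iff₀ (by linarith)]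
    constructor <;> linarith
  obtain ⟨τ, hτ, h⟩ := exists_hasUniformization_reciprocalCubic hc
  have hAR : (A : ℂ) + R ≠ 0 := by exact_mod_cast (add_pos hA0 hR0).ne'
  exact ⟨τ, hτ, h.quartic_of_reciprocalCubic hA hR hAR (by push_cast; rfl)⟩

theorem exists_hasUniformization_quartic_zero {p q : ℂ} {A R : ℝ}
    (hA : (Complex.sqrt p - Complex.sqrt q) ^ 2 = A) (hR : 4 * Complex.sqrt (p * q) = R)
    (hA0 : A < 0) (hR0 : 0 < R) (hAR : A + R ≠ 0) :
    ∃ τ : ℍ, τ.re = 0 ∧ HasUniformization (quartic p q) τ := by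
  have hc : 1 < |(A - R) / (A + R)| := by
    rw [← one_lt_sq_iff_one_lt_abs, div_pow, one_lt_div (by positivity)]
    nlinarith
  obtain ⟨τ, hτ, h⟩ := exists_hasUniformization_reciprocalCubic_of_one_lt_abs hc
  have hAR' : (A : ℂ) + R ≠ 0 := by exact_mod_cast hAR
  exact ⟨τ, hτ, h.quartic_of_reciprocalCubic hA hR hAR' (by push_cast; rfl)⟩

/-! ### Principal square roots -/

theorem sqrt_sq_eq_self (x : ℂ) : Complex.sqrt x ^ 2 = x := Complex.cpow_ofNat_inv_pow x 2

theorem sqrt_re_nonneg (x : ℂ) : 0 ≤ (Complex.sqrt x).re := by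
  rw [Complex.sqrt, Complex.cpow_inv_two_re]
  exact Real.sqrt_nonneg _

/-- The principal root never has negative real part. Writing p = z² with Re z > 0 thus removes all
questions of branches. -/
theorem sqrt_sq_of_re_pos {z : ℂ} (hz : 0 < z.re) : Complex.sqrt (z ^ 2) = z := by
  rcases sq_eq_sq_iff_eq_or_eq_neg.mp (sqrt_sq_eq_self (z ^ 2)) with h | h
  · exact h
  · have h1 := sqrt_re_nonneg (z ^ 2)
    rw [h, Complex.neg_re] at h1
    linarith

theorem sqrt_re_pos {x : ℂ} (hx : x.im ≠ 0) : 0 < (Complex.sqrt x).re := by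
  refine lt_of_le_of_ne (sqrt_re_nonneg x) fun h => hx ?_
  have h1 := congrArg Complex.im (sqrt_sq_eq_self x)
  rw [← h1, sq, Complex.mul_im, ← h]
  simp

theorem sqrt_ofReal {x : ℝ} (hx : 0 < x) : Complex.sqrt x = (√x : ℝ) := by
  have h := sqrt_sq_of_re_pos (z := (√x : ℝ)) (by simpa using hx)
  rwa [← Complex.ofReal_pow, Real.sq_sqrt hx.le] at h

theorem sqrt_neg_ofReal {x : ℝ} (hx : 0 < x) :
    Complex.sqrt (-x : ℝ) = (√x : ℝ) * Complex.I := by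
  rw [Complex.sqrt_eq_real_add_ite]
  simp [abs_of_pos hx]

/-- The difference of the roots is z - z̄ = 2 i Im z, so A < 0 for a nonreal conjugate pair, while A
+ R = 4 (Re z)² > 0. -/
theorem sqrt_conj_sub_sq {z : ℂ} (hz : 0 < z.re) :
    (Complex.sqrt (z ^ 2) - Complex.sqrt ((starRingEnd ℂ) (z ^ 2))) ^ 2 = (-4 * z.im ^ 2 : ℝ) := by
  rw [map_pow, sqrt_sq_of_re_pos hz, sqrt_sq_of_re_pos (by simpa using hz), Complex.sub_conj,
    mul_pow, Complex.I_sq]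
  push_cast
  ring

theorem sqrt_mul_conj {z : ℂ} (hz : 0 < z.re) :
    4 * Complex.sqrt (z ^ 2 * (starRingEnd ℂ) (z ^ 2)) = (4 * (z.re ^ 2 + z.im ^ 2) : ℝ) := by
  have h1 : z ^ 2 * (starRingEnd ℂ) (z ^ 2) = ((z.re ^ 2 + z.im ^ 2 : ℝ) : ℂ) ^ 2 := by
    rw [map_pow, ← mul_pow, Complex.mul_conj, Complex.normSq_apply]
    simp [sq]
  rw [h1, sqrt_sq_of_re_pos (by rw [Complex.ofReal_re]; positivity)]
  push_cast
  ring

/-! ### The amplitude curve of an elastica -/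

theorem exists_quartic_of_bothPos {p q : ℂ} (hpq : p ≠ q) (h : BothPos p q) :
    ∃ τ : ℍ, τ.re = 1 / 2 ∧ HasUniformization (quartic p q) τ := by
  obtain ⟨hp, hq, hp0, hq0⟩ := h
  obtain ⟨x, rfl⟩ : ∃ x : ℝ, p = x := ⟨p.re, Complex.ext rfl hp⟩
  obtain ⟨y, rfl⟩ : ∃ y : ℝ, q = y := ⟨q.re, Complex.ext rfl hq⟩
  rw [Complex.ofReal_re] at hp0 hq0
  refine exists_hasUniformization_quartic_half (A := (√x - √y) ^ 2) (R := 4 * √(x * y)) ?_ ?_ ?_ ?_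
  · rw [sqrt_ofReal hp0, sqrt_ofReal hq0]
    push_cast
    rfl
  · rw [← Complex.ofReal_mul, sqrt_ofReal (mul_pos hp0 hq0)]
    push_cast
    rfl
  · have : √x - √y ≠ 0 :=
      sub_ne_zero.mpr fun h => hpq (by rw [(Real.sqrt_inj hp0.le hq0.le).mp h])
    positivity
  · have := Real.sqrt_pos.mpr (mul_pos hp0 hq0)
    positivity

theorem exists_quartic_of_conjPair {p q : ℂ} (h : ConjPair p q) :
    ∃ τ : ℍ, τ.re = 0 ∧ HasUniformization (quartic p q) τ := by
  obtain ⟨rfl, hp⟩ := h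
  have hz := sqrt_re_pos hp
  have hz2 := sqrt_sq_eq_self p
  set z := Complex.sqrt p
  have hzi : z.im ≠ 0 := fun h0 => hp (by rw [← hz2, sq, Complex.mul_im, h0]; simp)
  rw [← hz2]
  refine exists_hasUniformization_quartic_zero (sqrt_conj_sub_sq hz) (sqrt_mul_conj hz) ?_ ?_ ?_
  · have : 0 < z.im ^ 2 := by positivity
    linarith
  · positivity
  · have : 0 < z.re ^ 2 := by positivity
    linarith

/-- The principal roots are imaginary, so A = -(√x - √y)² < 0 while R > 0. Since k² = -R / A, the
condition k² ≠ 1 is exactly A + R ≠ 0, that is, J does not degenerate. -/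
theorem exists_quartic_of_bothNonpos {p q : ℂ} (hpq : p ≠ q) (hp' : p ≠ 0) (hq' : q ≠ 0)
    (h : BothNonpos p q) (hk : jacobiModulus p q ^ 2 ≠ 1) :
    ∃ τ : ℍ, τ.re = 0 ∧ HasUniformization (quartic p q) τ := by
  obtain ⟨hp, hq, hp0, hq0⟩ := h
  obtain ⟨x, rfl⟩ : ∃ x : ℝ, p = (-x : ℝ) := ⟨-p.re, Complex.ext (by simp) (by simpa using hp)⟩
  obtain ⟨y, rfl⟩ : ∃ y : ℝ, q = (-y : ℝ) := ⟨-q.re, Complex.ext (by simp) (by simpa using hq)⟩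
  rw [Complex.ofReal_re] at hp0 hq0
  have hx : 0 < x := lt_of_le_of_ne (by linarith) fun h => hp' (by simp [← h])
  have hy : 0 < y := lt_of_le_of_ne (by linarith) fun h => hq' (by simp [← h])
  have hxy : √x - √y ≠ 0 :=
    sub_ne_zero.mpr fun h => hpq (by rw [(Real.sqrt_inj hx.le hy.le).mp h])
  have hA : (Complex.sqrt (-x : ℝ) - Complex.sqrt (-y : ℝ)) ^ 2 = (-(√x - √y) ^ 2 : ℝ) := by
    rw [sqrt_neg_ofReal hx, sqrt_neg_ofReal hy]
    push_cast
    linear_combination ((√x : ℂ) - √y) ^ 2 * Complex.I_sq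
  have hA0 : -(√x - √y) ^ 2 < 0 := neg_neg_of_pos (by positivity)
  have hR : 4 * Complex.sqrt ((-x : ℝ) * (-y : ℝ)) = (4 * √(x * y) : ℝ) := by
    rw [← Complex.ofReal_mul, neg_mul_neg, sqrt_ofReal (mul_pos hx hy)]
    push_cast
    rfl
  refine exists_hasUniformization_quartic_zero hA hR hA0 ?_ fun h0 => hk ?_
  · have := Real.sqrt_pos.mpr (mul_pos hx hy)
    positivity
  · have h1 : ((((-x : ℝ) : ℂ) * (-y : ℝ)) ^ (4⁻¹ : ℂ)) ^ 2 =
        Complex.sqrt ((-x : ℝ) * (-y : ℝ)) := by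
      rw [Complex.sqrt, ← Complex.cpow_nat_mul]
      norm_num
    rw [jacobiModulus, div_pow, hA, mul_pow, mul_pow, h1, Complex.I_sq,
      div_eq_one_iff_eq (by exact_mod_cast hA0.ne)]
    have h2 : ((-(√x - √y) ^ 2 : ℝ) : ℂ) + (4 * √(x * y) : ℝ) = 0 := by exact_mod_cast h0
    linear_combination -hR - h2

/-! ### The moduli of elasticas: both inclusions for both curves -/

theorem exists_ne_ne (a : Fin 3) : ∃ b c, a ≠ b ∧ a ≠ c ∧ b ≠ c := by
  revert a; decide

theorem toQuotient_mem_image {P : ℂ[X]} {τ τ₀ : ℍ} (h : IsPeriodRatio P τ) (h₀ : IsPeriodRatio P τ₀)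
    (hτ₀ : τ₀ ∈ twoLines) : toQuotient τ ∈ toQuotient '' twoLines :=
  ⟨τ₀, hτ₀, h.toQuotient_eq h₀⟩

/-- On E_e the parameter is c = s / 2: rhombic for s < 2, rectangular for s > 2. On J the two types
of elasticas exchange their lines. -/
theorem elasticaModuli_subset : elasticaModuli ⊆ toQuotient '' twoLines := by
  rintro _ ⟨Z, e, a, τ, hZ, hτ, rfl⟩
  obtain ⟨b, c, hab, hac, hbc⟩ := exists_ne_ne a
  obtain ⟨hpq, s, hs, h2, hne⟩ := hZ.mul_eq_one hab hac hbc
  have hs' : (e b - e a) + (e c - e a) = 2 * ((s / 2 : ℝ) : ℂ) := by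
    rw [hs]; push_cast; ring
  rcases lt_or_gt_of_ne hne with hlt | hgt
  · obtain ⟨τ₀, hτ₀, h⟩ := exists_hasUniformization_reciprocalCubic (c := s / 2)
      (abs_lt.mpr ⟨by linarith, by linarith⟩)
    exact toQuotient_mem_image hτ (h.cubic_of_reciprocalCubic hab hac hbc hpq hs').isPeriodRatio
      (Or.inr hτ₀)
  · obtain ⟨τ₀, hτ₀, h⟩ := exists_hasUniformization_reciprocalCubic_of_one_lt_abs (c := s / 2)
      (lt_abs.mpr (Or.inl (by linarith)))
    exact toQuotient_mem_image hτ (h.cubic_of_reciprocalCubic hab hac hbc hpq hs').isPeriodRatio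
      (Or.inl hτ₀)

theorem elasticaAmplitudeModuli_subset : elasticaAmplitudeModuli ⊆ toQuotient '' twoLines := by
  rintro _ ⟨Z, e, a, b, c, τ, hZ, hab, hac, hbc, hτ, rfl⟩
  obtain ⟨hpq, s, hs, h2, -⟩ := hZ.mul_eq_one hab hac hbc
  rcases bothPos_or_conjPair hpq hs h2 with h | h
  · obtain ⟨τ₀, hτ₀, h₀⟩ := exists_quartic_of_bothPos
      (fun h1 => hbc (hZ.1 (sub_left_inj.mp h1))) h
    exact toQuotient_mem_image hτ h₀.isPeriodRatio (Or.inr hτ₀)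
  · obtain ⟨τ₀, hτ₀, h₀⟩ := exists_quartic_of_conjPair h
    exact toQuotient_mem_image hτ h₀.isPeriodRatio (Or.inl hτ₀)

/-- A curve with prescribed differences of branch points that carries an elastica. -/
theorem exists_isGenusOneElastica_of_mul_eq_one {p q : ℂ} (hpq : p * q = 1) {s : ℝ}
    (hs : p + q = s) (h2 : -2 < s) (hne : s ≠ 2) : ∃ (Z : ℝ → ℂ) (e : Fin 3 → ℂ) (a b c : Fin 3),
      IsGenusOneElastica Z e a ∧ a ≠ b ∧ a ≠ c ∧ b ≠ c ∧ e b - e a = p ∧ e c - e a = q := by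
  obtain ⟨Z, hZ⟩ := exists_isGenusOneElastica (e := ![0, p, q]) (a := 0) (b := 1) (c := 2)
    (by decide) (by decide) (by decide) (by simpa using hpq) (by simpa using hs) h2 hne
  exact ⟨Z, _, 0, 1, 2, hZ, by decide, by decide, by decide, by simp, by simp⟩

theorem toQuotient_mem_elasticaModuli {p q c : ℂ} (hpq : p * q = 1) {s : ℝ}
    (hs : p + q = s) (h2 : -2 < s) (hne : s ≠ 2) (hc : p + q = 2 * c) {τ : ℍ}
    (h : HasUniformization (reciprocalCubic c) τ) : toQuotient τ ∈ elasticaModuli := by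
  obtain ⟨Z, e, i, j, k, hZ, hij, hik, hjk, rfl, rfl⟩ :=
    exists_isGenusOneElastica_of_mul_eq_one hpq hs h2 hne
  exact ⟨Z, e, i, τ, hZ, (h.cubic_of_reciprocalCubic hij hik hjk hpq hc).isPeriodRatio, rfl⟩

theorem toQuotient_mem_elasticaAmplitudeModuli {p q : ℂ} (hpq : p * q = 1) {s : ℝ}
    (hs : p + q = s) (h2 : -2 < s) (hne : s ≠ 2) {τ : ℍ}
    (h : HasUniformization (quartic p q) τ) : toQuotient τ ∈ elasticaAmplitudeModuli := by
  obtain ⟨Z, e, i, j, k, hZ, hij, hik, hjk, rfl, rfl⟩ :=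
    exists_isGenusOneElastica_of_mul_eq_one hpq hs h2 hne
  exact ⟨Z, e, i, j, k, τ, hZ, hij, hik, hjk, h.isPeriodRatio, rfl⟩

theorem two_lt_add_one_div {p : ℝ} (hp : 1 < p) : 2 < p + 1 / p := by
  have h : p + 1 / p - 2 = (p - 1) ^ 2 / p := by field_simp; ring
  have h' : 0 < (p - 1) ^ 2 / p := div_pos (pow_pos (by linarith) 2) (by linarith)
  linarith

theorem subset_elasticaModuli : toQuotient '' twoLines ⊆ elasticaModuli := by
  rintro _ ⟨τ, hτ | hτ, rfl⟩
  · obtain ⟨p, hp, h⟩ := exists_reciprocalCubic_of_re_eq_zero hτ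
    have hp0 : (p : ℂ) ≠ 0 := by exact_mod_cast (zero_lt_one.trans hp).ne'
    have h2 := two_lt_add_one_div hp
    exact toQuotient_mem_elasticaModuli (p := p) (q := 1 / p) (s := p + 1 / p)
      (mul_one_div_cancel hp0) (by push_cast; rfl) (by linarith) h2.ne' (by push_cast; ring) h
  · obtain ⟨c, hc, h⟩ := exists_reciprocalCubic_of_re_eq_half hτ
    have hc1 := (sq_lt_one_iff_abs_lt_one c).mpr hc
    rw [abs_lt] at hc
    have hr : (√(1 - c ^ 2) : ℂ) ^ 2 = 1 - c ^ 2 := by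
      exact_mod_cast Real.sq_sqrt (by linarith : (0 : ℝ) ≤ 1 - c ^ 2)
    -- Conjugate points of the unit circle with sum 2 c.
    exact toQuotient_mem_elasticaModuli (p := c + √(1 - c ^ 2) * Complex.I)
      (q := c - √(1 - c ^ 2) * Complex.I) (s := 2 * c)
      (by linear_combination hr - (√(1 - c ^ 2) : ℂ) ^ 2 * Complex.I_sq)
      (by push_cast; ring) (by linarith) (by linarith) (by ring) h

theorem subset_elasticaAmplitudeModuli : toQuotient '' twoLines ⊆ elasticaAmplitudeModuli := by
  rintro _ ⟨τ, hτ | hτ, rfl⟩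
  · obtain ⟨p, hp, h⟩ := exists_reciprocalCubic_of_re_eq_zero hτ
    -- The differences of branch points will be z² and its conjugate with z = √(1 - y²) + i y. Then
    -- A = -4 y², R = 4, and y is chosen so that (A - R) / (A + R) = -(1 + y²) / (1 - y²) = -(p +
    -- 1/p) / 2.
    set y : ℝ := (p - 1) / (p + 1) with hy
    have hp1 : p + 1 ≠ 0 := by linarith
    have hy0 : 0 < y := div_pos (by linarith) (by linarith)
    have hy1 : y < 1 := (div_lt_one (by linarith)).mpr (by linarith)
    have hy2 : y ^ 2 < 1 := by nlinarith
    have hx0 : 0 < √(1 - y ^ 2) := Real.sqrt_pos.mpr (by linarith)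
    have hx2 : √(1 - y ^ 2) ^ 2 = 1 - y ^ 2 := Real.sq_sqrt (by linarith)
    set z : ℂ := ⟨√(1 - y ^ 2), y⟩ with hz
    have hn : z * (starRingEnd ℂ) z = 1 := by
      have h1 : z.re * z.re + z.im * z.im = 1 := by
        change √(1 - y ^ 2) * √(1 - y ^ 2) + y * y = 1
        linear_combination hx2
      rw [Complex.mul_conj, Complex.normSq_apply, h1, Complex.ofReal_one]
    have hR := sqrt_mul_conj (z := z) hx0
    have hA := sqrt_conj_sub_sq (z := z) hx0
    have hc : -((p + 1 / p) / 2) =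
        (-4 * z.im ^ 2 - 4 * (z.re ^ 2 + z.im ^ 2)) / (-4 * z.im ^ 2 + 4 * (z.re ^ 2 + z.im ^ 2)) := by
      have h1 : z.re ^ 2 = 1 - y ^ 2 := hx2
      have h3 : z.im = y := rfl
      rw [h1, h3]
      have h4 : 1 - y ^ 2 = 4 * p / (p + 1) ^ 2 := by rw [hy]; field_simp; ring
      have h5 : 1 + y ^ 2 = 2 * (p ^ 2 + 1) / (p + 1) ^ 2 := by rw [hy]; field_simp; ring
      have h6 : (-4 * y ^ 2 - 4 * (1 - y ^ 2 + y ^ 2)) / (-4 * y ^ 2 + 4 * (1 - y ^ 2 + y ^ 2)) =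
          -((1 + y ^ 2) / (1 - y ^ 2)) := by
        have : 1 - y ^ 2 ≠ 0 := by linarith
        have h7 : -4 * y ^ 2 + 4 * (1 - y ^ 2 + y ^ 2) = 4 * (1 - y ^ 2) := by ring
        rw [h7]
        field_simp
        ring
      rw [h6, h4, h5]
      have : p ≠ 0 := by positivity
      field_simp
      norm_num
    have hU := h.reciprocalCubic_neg
    rw [← Complex.ofReal_neg, hc] at hU
    have hAR : ((-4 * z.im ^ 2 : ℝ) : ℂ) + (4 * (z.re ^ 2 + z.im ^ 2) : ℝ) ≠ 0 := by
      have : 0 < -4 * z.im ^ 2 + 4 * (z.re ^ 2 + z.im ^ 2) := by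
        have : 0 < z.re ^ 2 := pow_pos hx0 2
        linarith
      exact_mod_cast this.ne'
    refine toQuotient_mem_elasticaAmplitudeModuli (s := 2 * (1 - 2 * y ^ 2)) ?_ ?_ (by linarith)
      (by nlinarith) (hU.quartic_of_reciprocalCubic hA hR hAR (by push_cast; rfl))
    · rw [map_pow, ← mul_pow, hn, one_pow]
    · rw [Complex.add_conj, sq, Complex.mul_re]
      congr 1
      simp only [hz]
      linear_combination 2 * hx2
  · obtain ⟨c, hc, h⟩ := exists_reciprocalCubic_of_re_eq_half hτ
    rw [abs_lt] at hc
    -- The solution of c = (A - R) / (A + R) with R = 4, the value of R when the product of the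
    -- differences is 1.
    set A : ℝ := 4 * (1 + c) / (1 - c) with hA
    have hA0 : 0 < A := div_pos (by linarith) (by linarith)
    have hα : √A ^ 2 = A := Real.sq_sqrt hA0.le
    have hα0 : 0 < √A := Real.sqrt_pos.mpr hA0
    have hβ : √(A + 4) ^ 2 = A + 4 := Real.sq_sqrt (by linarith)
    have hβ2 : 2 < √(A + 4) := Real.lt_sqrt_of_sq_lt (by linarith)
    -- The positive solution of r - 1/r = √A; with differences r² and 1/r² this makes (√p - √q)² =
    -- A.
    set r : ℝ := (√A + √(A + 4)) / 2 with hr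
    have hr1 : 1 < r := by linarith
    have hr0 : r ≠ 0 := by linarith
    have hr2 : r ^ 2 = √A * r + 1 := by
      rw [hr]; linear_combination (hβ - hα) / 4
    have hinv : 1 / r = r - √A := by
      field_simp
      linear_combination -hr2
    have hpq : ((r : ℂ) ^ 2) * ((1 / r : ℝ) : ℂ) ^ 2 = 1 := by
      have : r ^ 2 * (1 / r) ^ 2 = 1 := by field_simp
      exact_mod_cast this
    have hs := two_lt_add_one_div (p := r ^ 2) (by nlinarith)
    have hA' : (Complex.sqrt ((r : ℂ) ^ 2) - Complex.sqrt (((1 / r : ℝ) : ℂ) ^ 2)) ^ 2 = (A : ℝ) := by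
      have h1 : 0 < 1 / r := by positivity
      rw [sqrt_sq_of_re_pos (by rw [Complex.ofReal_re]; linarith),
        sqrt_sq_of_re_pos (by rwa [Complex.ofReal_re]), hinv]
      push_cast
      rw [sub_sub_cancel]
      exact_mod_cast hα
    have hR : 4 * Complex.sqrt (((r : ℂ) ^ 2) * ((1 / r : ℝ) : ℂ) ^ 2) = (4 : ℝ) := by
      rw [hpq, Complex.sqrt_one]
      simp
    have hAR : (A : ℂ) + (4 : ℝ) ≠ 0 := by
      have : A + 4 ≠ 0 := by linarith
      exact_mod_cast this
    have hc' : (c : ℂ) = (A - (4 : ℝ)) / (A + (4 : ℝ)) := by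
      have : c = (A - 4) / (A + 4) := by
        have h1 : 1 - c ≠ 0 := by linarith
        rw [eq_div_iff (by linarith), hA]
        field_simp
        ring
      exact_mod_cast this
    refine toQuotient_mem_elasticaAmplitudeModuli (s := r ^ 2 + 1 / r ^ 2) hpq ?_ (by linarith) hs.ne'
      (h.quartic_of_reciprocalCubic hA' hR hAR hc')
    push_cast
    rw [one_div, one_div, inv_pow]

end GenusOne

theorem mainTheorem2 :
    -- the moduli of elasticas, read off the cubic curve and read off the quartic curve
    elasticaModuli = toQuotient '' twoLines ∧
    elasticaAmplitudeModuli = toQuotient '' twoLines ∧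
    -- the two types of elasticas
    (∀ (Z : ℝ → ℂ) (e : Fin 3 → ℂ) (a b c : Fin 3), a ≠ b → a ≠ c → b ≠ c →
      IsGenusOneElastica Z e a →
      BothPos (e b - e a) (e c - e a) ∨ ConjPair (e b - e a) (e c - e a)) ∧
    -- case I-1
    (∀ (e : Fin 3 → ℂ) (a b c : Fin 3), Function.Injective e → a ≠ b → a ≠ c → b ≠ c →
      BothPos (e b - e a) (e c - e a) →
      ∃ τ : ℍ, τ.re = 1 / 2 ∧ IsPeriodRatio (quartic (e b - e a) (e c - e a)) τ) ∧
    -- case I-2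
    (∀ (e : Fin 3 → ℂ) (a b c : Fin 3), Function.Injective e → a ≠ b → a ≠ c → b ≠ c →
      (BothNonpos (e b - e a) (e c - e a) ∧ jacobiModulus (e b - e a) (e c - e a) ^ 2 ≠ 1 ∨
        ConjPair (e b - e a) (e c - e a)) →
      ∃ τ : ℍ, τ.re = 0 ∧ IsPeriodRatio (quartic (e b - e a) (e c - e a)) τ) := by
  refine ⟨elasticaModuli_subset.antisymm subset_elasticaModuli,
    elasticaAmplitudeModuli_subset.antisymm subset_elasticaAmplitudeModuli, ?_, ?_, ?_⟩
  · intro Z e a b c hab hac hbc hZ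
    obtain ⟨hpq, s, hs, h2, -⟩ := hZ.mul_eq_one hab hac hbc
    exact bothPos_or_conjPair hpq hs h2
  · intro e a b c he hab hac hbc h
    obtain ⟨τ, hτ, hU⟩ := exists_quartic_of_bothPos (fun h1 => hbc (he (sub_left_inj.mp h1))) h
    exact ⟨τ, hτ, hU.isPeriodRatio⟩
  · rintro e a b c he hab hac hbc (⟨h, hk⟩ | h)
    · obtain ⟨τ, hτ, hU⟩ := exists_quartic_of_bothNonpos (fun h1 => hbc (he (sub_left_inj.mp h1)))
        (sub_ne_zero.mpr fun h1 => hab (he h1.symm)) (sub_ne_zero.mpr fun h1 => hac (he h1.symm)) h hk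
      exact ⟨τ, hτ, hU.isPeriodRatio⟩
    · obtain ⟨τ, hτ, hU⟩ := exists_quartic_of_conjPair h
      exact ⟨τ, hτ, hU.isPeriodRatio⟩
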